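/- **Proposition A.1.** Let $n\ge 1$, $0<\sigma<\alpha<1$, $1<p<\infty$ and $\frac{\sigma}{\alpha}<s<1$. Let $p_1\in(0,\infty]$ and $p_2\in(0,\infty)$ satisfy $$\frac1p=\frac1{p_1}+\frac1{p_2},\qquad \Bigl(1-\frac{\sigma}{\alpha s}\Bigr)p_1>1,\qquad \frac{\sigma}{s}\,p_2>1 .$$ Then there is a constant $C$, depending only on $n,\alpha,\sigma,s,p,p_1,p_2$, such that the following holds. Let $F:\mathbb C\to\mathbb C$ be Hölder continuous of order $\alpha$ with constant $K$, i.e. $|F(z)-F(w)|\le K|z-w|^\alpha$ for all $z,w\in\mathbb C$. Let $u:\mathbb R^n\to\mathbb C$ satisfy $|u|^{\alpha-\sigma/s}\in L^{p_1}(\mathbb R^n)$ and $|\nabla|^s u\in L^{\sigma p_2/s}(\mathbb R^n)$. Then $|\nabla|^\sigma F(u)\in L^p(\mathbb R^n)$ and $$\bigl\||\nabla|^\sigma F(u)\bigr\|_{L^p}\le C\,K\,\bigl\||u|^{\alpha-\frac{\sigma}{s}}\bigr\|_{L^{p_1}}\,\bigl\||\nabla|^s u\bigr\|_{L^{\sigma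 p_2/s}}^{\sigma/s}.$$ Here, for a Schwartz function $\varphi$ and $t>0$, $\widehat{|\nabla|^t\varphi}(\xi)=|\xi|^t\hat\varphi(\xi)$ with $\hat\varphi(\xi)=\int_{\mathbb R^n}e^{-2\pi i x\cdot\xi}\varphi(x)\,dx$. For a measurable function $f$ with $\int_{\mathbb R^n}|f(x)|(1+|x|)^{-n-t}\,dx<\infty$ (in particular for every $f\in L^r(\mathbb R^n)$, $1\le r\le\infty$), $|\nabla|^t f=g$ means $\int f\,|\nabla|^t\varphi\,dx=\int g\,\varphi\,dx$ for all Schwartz functions $\varphi$; the hypothesis on $|\nabla|^s u$ includes that $u$ is such a function with $t=s$, and the conclusion includes that $F(u)$ is such a function with $t=\sigma$. -/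

import Mathlib

open MeasureTheory
open scoped ENNReal NNReal FourierTransform SchwartzMap

/-- Fractional differentiation `|∇|^s φ` of a Schwartz function `φ` on `ℝⁿ`, defined on the Fourier
side as multiplication by `|ξ|^s`, where `φ̂(ξ) = ∫ e^{-2πi x·ξ} φ(x) dx`. -/
noncomputable def fracDerivSchwartz {n : ℕ} (s : ℝ) (φ : 𝓢(EuclideanSpace ℝ (Fin n), ℂ)) :
    EuclideanSpace ℝ (Fin n) → ℂ :=
  𝓕⁻ (fun ξ : EuclideanSpace ℝ (Fin n) =>
    ((‖ξ‖ ^ s : ℝ) : ℂ) * 𝓕 (φ : EuclideanSpace ℝ (Fin n) → ℂ) ξ)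

/-- `HasFracDeriv s u g` says that `|∇|^s u = g` (for `s > 0`), in the sense of distributions on
`ℝⁿ`: `⟨u, |∇|^s φ⟩ = ⟨g, φ⟩` for all Schwartz functions `φ`. Since `|∇|^s φ` is continuous and
`O((1 + |x|)^{-n-s})` but in general not Schwartz, the pairing on the left is defined for those `u`
that are integrable against the weight `(1 + |x|)^{-n-s}`; this includes every `u` in `L^r(ℝⁿ)`,
`1 ≤ r ≤ ∞`. -/
def HasFracDeriv {n : ℕ} (s : ℝ) (u g : EuclideanSpace ℝ (Fin n) → ℂ) : Prop :=
  Integrable (fun x : EuclideanSpace ℝ (Fin n) =>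
    (((1 + ‖x‖) ^ (-((n : ℝ) + s)) : ℝ) : ℂ) * u x) volume ∧
  ∀ φ : 𝓢(EuclideanSpace ℝ (Fin n), ℂ),
    Integrable (fun x => g x * φ x) volume ∧
    ∫ x, u x * fracDerivSchwartz s φ x = ∫ x, g x * φ x

/-! Write `M` for the maximal function, `g = |∇|^s u`, `f = F ∘ u`, `τ = α s`. A Littlewood–Paley
telescoping gives the Hajłasz inequality `|u x - u y| ≤ C |x - y|^s (Mg x + Mg y)` at almost all `x,
y` (`exists_norm_sub_le_maximalFn`). Composing with the Hölder function `F` gives two bounds for the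
increments of `f`: `C K |x - y|^τ (G x + G y)` with `G = (Mg)^α`, and `K (U x + U y)` with `U =
|u|^α`.

For `0 < σ < 1`, `|∇|^σ f` is a constant multiple of `∫ (f (x + y) - f x) |y|^{-n-σ} dy`
(`exists_hasFracDeriv_singularIntegral`). The first bound is used for `|y| ≤ A` and the second for
`|y| > A`; as `σ < τ`, both pieces converge and are at most `A^{τ-σ} (MG + G)` and `A^{-σ} (MU + U)`
up to constants. Optimizing in `A` gives the pointwise bound `C K (MG + G)^{σ/τ} (MU + U)^{1-σ/τ}`
(`exists_lintegral_increment_le`).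

Hölder's inequality places the first factor in `L^{p₂}` and the second in `L^{p₁}`. The
Hardy–Littlewood theorem (`exists_eLpNorm_maximalFn_le`) removes the outer maximal functions and
then the one in `G`; the conditions `(1 - σ/(α s)) p₁ > 1` and `(σ/s) p₂ > 1` say exactly that the
exponents it meets exceed one. Since `α σ/τ = σ/s`, what remains is `‖g‖^{σ/s}` and the norm of
`|u|^{α-σ/s}`. -/

/-! ### Maximal function: measurability and weak type bounds. -/

section Maximal

set_option linter.unusedSectionVars false

variable {E : Type*} [NormedAddCommGroup E] [NormedSpace ℝ E] [FiniteDimensional ℝ E]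
  [MeasurableSpace E] [BorelSpace E] (μ : Measure E) [μ.IsAddHaarMeasure]

/-- The centred Hardy–Littlewood maximal function over balls of dyadic radius. -/
noncomputable def maximalFn (f : E → ℝ≥0∞) (x : E) : ℝ≥0∞ :=
  ⨆ k : ℤ, (∫⁻ z in Metric.closedBall x ((2 : ℝ) ^ k), f z ∂μ) /
    μ (Metric.closedBall x ((2 : ℝ) ^ k))

variable {μ}

lemma measure_closedBall_two_zpow_ne_zero (x : E) (k : ℤ) :
    μ (Metric.closedBall x ((2 : ℝ) ^ k)) ≠ 0 :=
  (Metric.measure_closedBall_pos μ x (by positivity)).ne'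

lemma measure_closedBall_ne_top' (x : E) (r : ℝ) :
    μ (Metric.closedBall x r) ≠ ∞ := measure_closedBall_lt_top.ne

lemma lintegral_closedBall_two_zpow_le (f : E → ℝ≥0∞) (x : E) (k : ℤ) :
    ∫⁻ z in Metric.closedBall x ((2 : ℝ) ^ k), f z ∂μ ≤
      maximalFn μ f x * μ (Metric.closedBall x ((2 : ℝ) ^ k)) := by
  rw [← ENNReal.div_le_iff (measure_closedBall_two_zpow_ne_zero x k)
    (measure_closedBall_ne_top' x _)]
  exact le_iSup (fun k : ℤ => (∫⁻ z in Metric.closedBall x ((2 : ℝ) ^ k), f z ∂μ) /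
    μ (Metric.closedBall x ((2 : ℝ) ^ k))) k

/-- Averages over arbitrary balls are controlled by the dyadic maximal function. -/
lemma lintegral_closedBall_le_maximalFn (f : E → ℝ≥0∞) (x : E) {r : ℝ} (hr : 0 < r) :
    ∫⁻ z in Metric.closedBall x r, f z ∂μ ≤
      ENNReal.ofReal ((2 * r) ^ Module.finrank ℝ E) * μ (Metric.ball 0 1) *
        maximalFn μ f x := by
  -- Here `2 ^ k < r ≤ 2 ^ (k + 1)`, so rounding the radius up to a dyadic one at most doubles it.
  obtain ⟨k, hk1, hk2⟩ := exists_mem_Ioc_zpow hr (one_lt_two : (1 : ℝ) < 2)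
  have h2 : (2 : ℝ) ^ (k + 1) ≤ 2 * r := by
    rw [zpow_add_one₀ two_ne_zero, mul_comm]; linarith
  calc ∫⁻ z in Metric.closedBall x r, f z ∂μ
      ≤ ∫⁻ z in Metric.closedBall x ((2 : ℝ) ^ (k + 1)), f z ∂μ :=
        lintegral_mono_set (Metric.closedBall_subset_closedBall hk2)
    _ ≤ maximalFn μ f x * μ (Metric.closedBall x ((2 : ℝ) ^ (k + 1))) :=
        lintegral_closedBall_two_zpow_le f x _
    _ ≤ maximalFn μ f x * μ (Metric.closedBall x (2 * r)) := by
        gcongr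
    _ = _ := by
        rw [Measure.addHaar_closedBall μ x (by positivity), mul_comm]

lemma measurable_lintegral_closedBall {f : E → ℝ≥0∞} (hf : AEMeasurable f μ) (r : ℝ) :
    Measurable fun x => ∫⁻ z in Metric.closedBall x r, f z ∂μ := by
  have h1 : ∀ x, ∫⁻ z in Metric.closedBall x r, f z ∂μ =
      ∫⁻ z, (Set.indicator {p : E × E | dist p.2 p.1 ≤ r} (fun p => hf.mk f p.2)) (x, z) ∂μ := by
    intro x
    rw [← lintegral_indicator Metric.isClosed_closedBall.measurableSet]
    apply lintegral_congr_ae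
    filter_upwards [hf.ae_eq_mk] with z hz
    simp only [Set.indicator, Metric.mem_closedBall, Set.mem_ofPred_eq, hz]
  simp_rw [h1]
  apply Measurable.lintegral_prod_right'
  apply Measurable.indicator
  · exact hf.measurable_mk.comp measurable_snd
  · exact measurableSet_le (by fun_prop) (by fun_prop)

/-- Restricting to dyadic radii makes this a countable supremum of measurable functions. -/
lemma measurable_maximalFn {f : E → ℝ≥0∞} (hf : AEMeasurable f μ) :
    Measurable (maximalFn μ f) := by
  apply Measurable.iSup
  intro k
  apply Measurable.div (measurable_lintegral_closedBall hf _)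
  have : ∀ x : E, μ (Metric.closedBall x ((2 : ℝ) ^ k)) = μ (Metric.closedBall 0 ((2 : ℝ) ^ k)) :=
    fun x => by
      rw [Measure.addHaar_closedBall μ x (by positivity),
        Measure.addHaar_closedBall μ 0 (by positivity)]
  simp_rw [this]
  exact measurable_const

/-- The weak type `(1,1)` bound for the maximal function. -/
lemma mul_measure_lt_maximalFn_le (hd : 1 ≤ Module.finrank ℝ E) (f : E → ℝ≥0∞)
    {t : ℝ≥0∞} (ht0 : t ≠ 0) (ht : t ≠ ∞) :
    t * μ {x | t < maximalFn μ f x} ≤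
      ENNReal.ofReal (5 ^ Module.finrank ℝ E) * ∫⁻ z, f z ∂μ := by
  set d := Module.finrank ℝ E
  by_cases hI : ∫⁻ z, f z ∂μ = ∞
  · rw [hI, ENNReal.mul_top]
    · exact le_top
    · simp
  set S : Set (E × ℤ) := {a | t * μ (Metric.closedBall a.1 ((2 : ℝ) ^ a.2)) ≤
    ∫⁻ z in Metric.closedBall a.1 ((2 : ℝ) ^ a.2), f z ∂μ} with hS
  have hμ1 : μ (Metric.ball (0 : E) 1) ≠ 0 := (Metric.measure_ball_pos μ 0 one_pos).ne'
  have hμ1' : μ (Metric.ball (0 : E) 1) ≠ ∞ := measure_ball_lt_top.ne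
  have hne : t * μ (Metric.ball (0 : E) 1) ≠ 0 := mul_ne_zero ht0 hμ1
  have hne' : t * μ (Metric.ball (0 : E) 1) ≠ ∞ := ENNReal.mul_ne_top ht hμ1'
  -- Vitali's covering lemma needs bounded radii. A ball in `S` of radius `r` satisfies `t * μ (ball
  -- 0 1) * r ^ d ≤ ∫ f < ∞`, and `r ≤ r ^ d` once `1 ≤ r`, because `1 ≤ d`.
  have hrad : ∀ a ∈ S, (2 : ℝ) ^ a.2 ≤
      max 1 ((∫⁻ z, f z ∂μ) / (t * μ (Metric.ball (0 : E) 1))).toReal := by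
    intro a ha
    have h1 := (Set.mem_ofPred_eq ▸ ha : _ ≤ _).trans (setLIntegral_le_lintegral _ f)
    rw [Measure.addHaar_closedBall μ a.1 (by positivity), mul_left_comm,
      ← ENNReal.le_div_iff_mul_le (Or.inl hne) (Or.inl hne'),
      ENNReal.ofReal_le_iff_le_toReal (ENNReal.div_ne_top hI hne)] at h1
    rcases le_total ((2 : ℝ) ^ a.2) 1 with h | h
    · exact le_max_of_le_left h
    · refine le_max_of_le_right (le_trans ?_ h1)
      exact le_self_pow₀ h (by omega)
  obtain ⟨u, huS, hdisj, hcov⟩ := Vitali.exists_disjoint_subfamily_covering_enlargement_closedBall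
    S (fun a => a.1) (fun a => (2 : ℝ) ^ a.2) _ hrad 5 (by norm_num)
  have hcount : u.Countable := hdisj.countable_of_nonempty_interior (fun a _ => by
    refine ⟨a.1, Metric.ball_subset_interior_closedBall (Metric.mem_ball_self (by positivity))⟩)
  have hsub : {x | t < maximalFn μ f x} ⊆
      ⋃ a ∈ u, Metric.closedBall a.1 (5 * (2 : ℝ) ^ a.2) := by
    intro x hx
    obtain ⟨k, hk⟩ := lt_iSup_iff.1 (show t < maximalFn μ f x from hx)
    have hmem : (x, k) ∈ S := by
      rw [ENNReal.lt_div_iff_mul_lt (Or.inl (measure_closedBall_two_zpow_ne_zero x k))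
        (Or.inl (measure_closedBall_ne_top' x _))] at hk
      exact hk.le
    obtain ⟨b, hb, hb'⟩ := hcov _ hmem
    exact Set.mem_biUnion hb (hb' (Metric.mem_closedBall_self (by positivity)))
  calc t * μ {x | t < maximalFn μ f x}
      ≤ t * ∑' a : u, μ (Metric.closedBall a.1.1 (5 * (2 : ℝ) ^ a.1.2)) := by
        gcongr
        exact (measure_mono hsub).trans (measure_biUnion_le μ hcount _)
    _ = ENNReal.ofReal (5 ^ d) *
          ∑' a : u, t * μ (Metric.closedBall a.1.1 ((2 : ℝ) ^ a.1.2)) := by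
        rw [ENNReal.tsum_mul_left, mul_left_comm, ← ENNReal.tsum_mul_left (a := ENNReal.ofReal _)]
        congr 2
        ext a
        rw [Measure.addHaar_closedBall_mul μ _ (by norm_num) (by positivity),
          Measure.addHaar_closedBall_center μ a.1.1]
    _ ≤ ENNReal.ofReal (5 ^ d) *
          ∑' a : u, ∫⁻ z in Metric.closedBall a.1.1 ((2 : ℝ) ^ a.1.2), f z ∂μ := by
        gcongr with a
        exact huS a.2
    _ = ENNReal.ofReal (5 ^ d) *
          ∫⁻ z in ⋃ a ∈ u, Metric.closedBall a.1 ((2 : ℝ) ^ a.2), f z ∂μ := by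
        rw [lintegral_biUnion hcount (fun a _ => Metric.isClosed_closedBall.measurableSet) hdisj]
    _ ≤ _ := by
        gcongr
        exact Measure.restrict_le_self

/-- The part of `f` below height `t` adds at most `t` to any mean, so a maximal value above `2 t` is
caused by the part above `t`. This localized weak bound is what interpolation with `L^∞` requires.
-/
lemma mul_measure_two_mul_lt_maximalFn_le (hd : 1 ≤ Module.finrank ℝ E) (f : E → ℝ≥0∞)
    {t : ℝ≥0∞} (ht0 : t ≠ 0) (ht : t ≠ ∞) :
    t * μ {x | 2 * t < maximalFn μ f x} ≤
      ENNReal.ofReal (5 ^ Module.finrank ℝ E) * ∫⁻ z, Set.indicator {z | t < f z} f z ∂μ := by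
  refine le_trans ?_ (mul_measure_lt_maximalFn_le hd (Set.indicator {z | t < f z} f) ht0 ht)
  refine mul_le_mul_right (measure_mono fun x hx => ?_) _
  simp only [Set.mem_ofPred_eq] at hx ⊢
  have key : maximalFn μ f x ≤ maximalFn μ (Set.indicator {z | t < f z} f) x + t := by
    apply iSup_le
    intro k
    rw [ENNReal.div_le_iff (measure_closedBall_two_zpow_ne_zero x k)
      (measure_closedBall_ne_top' x _), add_mul]
    calc ∫⁻ z in Metric.closedBall x ((2 : ℝ) ^ k), f z ∂μ
        ≤ ∫⁻ z in Metric.closedBall x ((2 : ℝ) ^ k),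
            (Set.indicator {z | t < f z} f z + t) ∂μ := by
          apply lintegral_mono
          intro z
          by_cases hz : t < f z
          · simp [Set.indicator, hz]
          · simp only [Set.indicator, Set.mem_ofPred_eq, hz, if_false, zero_add]
            exact not_lt.1 hz
      _ = (∫⁻ z in Metric.closedBall x ((2 : ℝ) ^ k), Set.indicator {z | t < f z} f z ∂μ)
            + t * μ (Metric.closedBall x ((2 : ℝ) ^ k)) := by
          rw [lintegral_add_right _ measurable_const, setLIntegral_const]
      _ ≤ _ := by
          gcongr
          exact lintegral_closedBall_two_zpow_le _ x k
  have h2 := hx.trans_le key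
  rw [two_mul] at h2
  exact lt_of_add_lt_add_right h2

end Maximal

/-! ### Layer-cake formulas and the strong maximal theorem. -/

lemma setLIntegral_rpow_sub_one_eq {b c : ℝ} (hb : 0 ≤ b) (hc : 0 < c) :
    ∫⁻ t in Set.Ioo 0 b, ENNReal.ofReal (c * t ^ (c - 1)) = ENNReal.ofReal (b ^ c) := by
  have hint : IntervalIntegrable (fun t : ℝ => c * t ^ (c - 1)) volume 0 b :=
    (intervalIntegral.intervalIntegrable_rpow' (by linarith)).const_mul c
  rw [← ofReal_integral_eq_lintegral_ofReal]
  · congr 1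
    rw [← integral_Ioc_eq_integral_Ioo, ← intervalIntegral.integral_of_le hb,
      intervalIntegral.integral_const_mul, integral_rpow (Or.inl (by linarith))]
    rw [sub_add_cancel, Real.zero_rpow hc.ne', sub_zero, mul_div_cancel₀ _ hc.ne']
  · exact ((intervalIntegrable_iff_integrableOn_Ioo_of_le hb).1 hint)
  · filter_upwards [ae_restrict_mem measurableSet_Ioo] with t ht
    have := ht.1
    positivity

/-- Layer cake for a single value. The value `∞` is included because a maximal function may be
infinite; it follows from the finite values by monotonicity. -/
lemma ENNReal.rpow_eq_setLIntegral (a : ℝ≥0∞) {c : ℝ} (hc : 0 < c) :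
    a ^ c = ∫⁻ t in Set.Ioi (0 : ℝ), Set.indicator {t | ENNReal.ofReal t < a}
      (fun t => ENNReal.ofReal (c * t ^ (c - 1))) t := by
  have hfin : ∀ b : ℝ, 0 ≤ b → ∫⁻ t in Set.Ioi (0 : ℝ),
      Set.indicator {t | ENNReal.ofReal t < ENNReal.ofReal b}
      (fun t => ENNReal.ofReal (c * t ^ (c - 1))) t = ENNReal.ofReal (b ^ c) := by
    intro b hb
    rw [← setLIntegral_rpow_sub_one_eq hb hc, lintegral_indicator
      (measurableSet_lt ENNReal.measurable_ofReal measurable_const), Measure.restrict_restrict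
      (measurableSet_lt ENNReal.measurable_ofReal measurable_const)]
    congr 2
    ext t
    simp only [Set.mem_inter_iff, Set.mem_ofPred_eq, Set.mem_Ioi, Set.mem_Ioo]
    constructor
    · rintro ⟨h1, h2⟩
      exact ⟨h2, (ENNReal.ofReal_lt_ofReal_iff_of_nonneg h2.le).1 h1⟩
    · rintro ⟨h1, h2⟩
      exact ⟨(ENNReal.ofReal_lt_ofReal_iff_of_nonneg h1.le).2 h2, h1⟩
  induction a using ENNReal.recTopCoe with
  | top =>
    rw [ENNReal.top_rpow_of_pos hc, eq_comm, eq_top_iff]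
    have : ∀ N : ℝ≥0, (N : ℝ≥0∞) ≤ ∫⁻ t in Set.Ioi (0 : ℝ),
        Set.indicator {t | ENNReal.ofReal t < ∞}
        (fun t => ENNReal.ofReal (c * t ^ (c - 1))) t := by
      intro N
      have h1 := hfin ((N : ℝ) ^ (c⁻¹)) (by positivity)
      rw [← Real.rpow_mul (NNReal.coe_nonneg N), inv_mul_cancel₀ hc.ne', Real.rpow_one,
        ENNReal.ofReal_coe_nnreal] at h1
      rw [← h1]
      apply lintegral_mono
      intro t
      simp only [ENNReal.ofReal_lt_top, Set.ofPred_true, Set.indicator_univ]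
      exact Set.indicator_le_self _ _ _
    exact ENNReal.le_of_forall_nnreal_lt (fun r _ => this r)
  | coe a =>
    have h1 := hfin a a.2
    rw [ENNReal.ofReal_coe_nnreal] at h1
    rw [h1, ← ENNReal.ofReal_rpow_of_nonneg (NNReal.coe_nonneg a) hc.le, ENNReal.ofReal_coe_nnreal]

section MaximalStrong

set_option linter.unusedSectionVars false

variable {E : Type*} [NormedAddCommGroup E] [NormedSpace ℝ E] [FiniteDimensional ℝ E]
  [MeasurableSpace E] [BorelSpace E] {μ : Measure E} [μ.IsAddHaarMeasure]

/-- Tonelli applied to the layer cake. The weight `g` allows `f ^ q` to be split as `f * f ^ (q -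
1)`, matching the integral of `f` over `{t < f}` in the weak bound. -/
lemma lintegral_rpow_eq_setLIntegral_measure {f : E → ℝ≥0∞} (hf : Measurable f) {c : ℝ}
    (hc : 0 < c) (g : E → ℝ≥0∞) (hg : Measurable g) :
    ∫⁻ x, g x * f x ^ c ∂μ = ∫⁻ t in Set.Ioi (0 : ℝ), ENNReal.ofReal (c * t ^ (c - 1)) *
      ∫⁻ x, Set.indicator {x | ENNReal.ofReal t < f x} g x ∂μ := by
  have hm : MeasurableSet {p : E × ℝ | ENNReal.ofReal p.2 < f p.1} :=
    measurableSet_lt (ENNReal.measurable_ofReal.comp measurable_snd) (hf.comp measurable_fst)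
  have h1 : ∀ x, g x * f x ^ c = ∫⁻ t in Set.Ioi (0 : ℝ),
      Set.indicator {p : E × ℝ | ENNReal.ofReal p.2 < f p.1}
        (fun p => g p.1 * ENNReal.ofReal (c * p.2 ^ (c - 1))) (x, t) := by
    intro x
    rw [ENNReal.rpow_eq_setLIntegral _ hc, ← lintegral_const_mul]
    · apply lintegral_congr
      intro t
      simp [Set.indicator]
    · apply Measurable.indicator
      · fun_prop
      · exact measurableSet_lt ENNReal.measurable_ofReal measurable_const
  simp_rw [h1]
  rw [lintegral_lintegral_swap]
  · apply lintegral_congr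
    intro t
    rw [← lintegral_const_mul]
    · apply lintegral_congr
      intro x
      simp only [Set.indicator, Set.mem_ofPred_eq]
      split_ifs <;> simp [mul_comm]
    · exact hg.indicator (measurableSet_lt measurable_const hf)
  · apply Measurable.aemeasurable
    exact Measurable.indicator (by fun_prop) hm

/-- The Hardy–Littlewood maximal theorem for finite exponents, for measurable functions. -/
lemma lintegral_maximalFn_rpow_le (hd : 1 ≤ Module.finrank ℝ E) {q : ℝ} (hq : 1 < q)
    {f : E → ℝ≥0∞} (hf : Measurable f) :
    ∫⁻ x, maximalFn μ f x ^ q ∂μ ≤ ENNReal.ofReal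
      (2 ^ q * (5 ^ Module.finrank ℝ E * (q / (q - 1)))) * ∫⁻ x, f x ^ q ∂μ := by
  set d := Module.finrank ℝ E
  have hq0 : 0 < q := by linarith
  have hq1 : 0 < q - 1 := by linarith
  have hM := measurable_maximalFn hf.aemeasurable (μ := μ)
  -- Halving turns the level `2 t` of the localized weak bound into `t`, at the price of the factor
  -- `2 ^ q`.
  have h1 : ∫⁻ x, maximalFn μ f x ^ q ∂μ =
      ENNReal.ofReal (2 ^ q) * ∫⁻ x, (1 : ℝ≥0∞) * (maximalFn μ f x / 2) ^ q ∂μ := by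
    rw [← lintegral_const_mul]
    · apply lintegral_congr
      intro x
      rw [one_mul, ENNReal.div_rpow_of_nonneg _ _ hq0.le,
        ← ENNReal.ofReal_rpow_of_pos two_pos, ENNReal.ofReal_ofNat, ENNReal.mul_div_cancel]
      · simp
      · simp
    · fun_prop
  have h2 : ∫⁻ x, f x ^ q ∂μ = ∫⁻ x, f x * f x ^ (q - 1) ∂μ := by
    apply lintegral_congr
    intro x
    conv_rhs => rw [← ENNReal.rpow_one (f x), ← ENNReal.rpow_mul, one_mul]
    rw [← ENNReal.rpow_add_of_nonneg _ _ one_pos.le hq1.le]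
    congr 1
    ring
  -- Both sides become integrals over levels `t`, with weight `1` and power `q` on the left and
  -- weight `f` and power `q - 1` on the right; the integrands are then compared by the localized
  -- weak bound.
  rw [h1, h2, lintegral_rpow_eq_setLIntegral_measure (hM.div_const 2) hq0 _ measurable_const,
    lintegral_rpow_eq_setLIntegral_measure hf hq1 _ hf, ENNReal.ofReal_mul (by positivity),
    mul_assoc]
  gcongr
  rw [← lintegral_const_mul' _ _ ENNReal.ofReal_ne_top]
  apply setLIntegral_mono' measurableSet_Ioi
  intro t ht
  have ht' : (0 : ℝ) < t := ht
  have hset : {x | ENNReal.ofReal t < maximalFn μ f x / 2} =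
      {x | 2 * ENNReal.ofReal t < maximalFn μ f x} := by
    ext x
    simp only [Set.mem_ofPred_eq]
    rw [ENNReal.lt_div_iff_mul_lt (by simp) (by simp), mul_comm]
  have hmeas : MeasurableSet {x | 2 * ENNReal.ofReal t < maximalFn μ f x} :=
    measurableSet_lt measurable_const hM
  have h3 := mul_measure_two_mul_lt_maximalFn_le (μ := μ) hd f
    (t := ENNReal.ofReal t) (by simpa using ht') ENNReal.ofReal_ne_top
  rw [hset, lintegral_indicator hmeas, setLIntegral_const, one_mul]
  calc ENNReal.ofReal (q * t ^ (q - 1)) * μ {x | 2 * ENNReal.ofReal t < maximalFn μ f x}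
      = ENNReal.ofReal (q * t ^ (q - 1 - 1)) * (ENNReal.ofReal t *
          μ {x | 2 * ENNReal.ofReal t < maximalFn μ f x}) := by
        rw [← mul_assoc, ← ENNReal.ofReal_mul (by positivity)]
        congr 2
        rw [mul_assoc, ← Real.rpow_add_one ht'.ne']
        congr 2
        ring
    _ ≤ ENNReal.ofReal (q * t ^ (q - 1 - 1)) * (ENNReal.ofReal (5 ^ d) *
          ∫⁻ z, Set.indicator {z | ENNReal.ofReal t < f z} f z ∂μ) := by gcongr
    _ = _ := by
        rw [← mul_assoc, ← mul_assoc, ← ENNReal.ofReal_mul (by positivity),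
          ← ENNReal.ofReal_mul (by positivity)]
        congr 2
        field_simp

/-- The Hardy–Littlewood maximal theorem. -/
theorem exists_eLpNorm_maximalFn_le (μ : Measure E) [μ.IsAddHaarMeasure]
    (hd : 1 ≤ Module.finrank ℝ E) {q : ℝ≥0∞} (hq : 1 < q) :
    ∃ C : ℝ≥0, ∀ f : E → ℝ≥0∞, AEMeasurable f μ →
      eLpNorm (maximalFn μ f) q μ ≤ C * eLpNorm f q μ := by
  by_cases hqt : q = ∞
  · refine ⟨1, fun f hf => ?_⟩
    subst hqt
    rw [ENNReal.coe_one, one_mul, eLpNorm_exponent_top, eLpNorm_exponent_top]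
    apply eLpNormEssSup_le_of_ae_enorm_bound
    refine Filter.Eventually.of_forall fun x => ?_
    simp only [enorm_eq_self]
    apply iSup_le
    intro k
    rw [ENNReal.div_le_iff (measure_closedBall_two_zpow_ne_zero x k)
      (measure_closedBall_ne_top' x _), ← setLIntegral_const]
    apply lintegral_mono_ae
    apply ae_restrict_of_ae
    simpa using enorm_ae_le_eLpNormEssSup f μ
  · have hq1 : 1 < q.toReal := by
      rw [← ENNReal.toReal_one]
      exact (ENNReal.toReal_lt_toReal ENNReal.one_ne_top hqt).2 hq
    have hq0 : q ≠ 0 := (zero_lt_one.trans hq).ne'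
    set D := (2 : ℝ) ^ q.toReal * (5 ^ Module.finrank ℝ E * (q.toReal / (q.toReal - 1)))
    refine ⟨D.toNNReal ^ (1 / q.toReal), fun f hf => ?_⟩
    have hMeq : maximalFn μ f = maximalFn μ (hf.mk f) := by
      ext x
      unfold maximalFn
      congr 1
      ext k
      congr 1
      exact lintegral_congr_ae (ae_restrict_of_ae hf.ae_eq_mk)
    rw [hMeq, eLpNorm_congr_ae hf.ae_eq_mk, eLpNorm_eq_lintegral_rpow_enorm_toReal hq0 hqt,
      eLpNorm_eq_lintegral_rpow_enorm_toReal hq0 hqt,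
      ENNReal.coe_rpow_of_nonneg _ (by positivity), ← ENNReal.mul_rpow_of_nonneg _ _
          (by positivity)]
    gcongr
    simpa using! lintegral_maximalFn_rpow_le (μ := μ) hd hq1 hf.measurable_mk

end MaximalStrong

/-! ### Radial kernels controlled by the maximal function. -/

lemma setLIntegral_Ioi_rpow_eq {a c : ℝ} (ha : 0 < a) (hc : 0 < c) :
    ∫⁻ t in Set.Ioi a, ENNReal.ofReal (c * t ^ (-c - 1)) = ENNReal.ofReal (a ^ (-c)) := by
  rw [← ofReal_integral_eq_lintegral_ofReal]
  · congr 1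
    rw [integral_const_mul, integral_Ioi_rpow_of_lt (by linarith) ha]
    rw [sub_add_cancel]
    field_simp
  · exact (integrableOn_Ioi_rpow_of_lt (by linarith) ha).const_mul c
  · filter_upwards [ae_restrict_mem measurableSet_Ioi] with t ht
    have : 0 < t := ha.trans ht
    positivity

section Kernels

set_option linter.unusedSectionVars false

variable {E : Type*} [NormedAddCommGroup E] [NormedSpace ℝ E] [FiniteDimensional ℝ E]
  [MeasurableSpace E] [BorelSpace E] {μ : Measure E} [μ.IsAddHaarMeasure]

/-- A radially decreasing kernel is a superposition of indicators of balls about `x`. Tonelli thus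
reduces integration against it to ball integrals, which the maximal function controls. -/
lemma lintegral_mul_setLIntegral_Ici {f : E → ℝ≥0∞} (hf : AEMeasurable f μ) (x : E)
    {m : ℝ → ℝ≥0∞} (hm : Measurable m) :
    ∫⁻ z, f z * (∫⁻ r in Set.Ici ‖z - x‖, m r) ∂μ =
      ∫⁻ r, m r * ∫⁻ z in Metric.closedBall x r, f z ∂μ := by
  have hms : MeasurableSet {p : E × ℝ | ‖p.1 - x‖ ≤ p.2} :=
    measurableSet_le (by fun_prop) (by fun_prop)
  have h1 : ∀ᵐ z ∂μ, f z * (∫⁻ r in Set.Ici ‖z - x‖, m r) =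
      ∫⁻ r, Set.indicator {p : E × ℝ | ‖p.1 - x‖ ≤ p.2} (fun p => hf.mk f p.1 * m p.2) (z, r) := by
    filter_upwards [hf.ae_eq_mk] with z hz
    rw [hz, ← lintegral_indicator measurableSet_Ici, ← lintegral_const_mul]
    · apply lintegral_congr
      intro r
      simp [Set.indicator]
    · exact hm.indicator measurableSet_Ici
  rw [lintegral_congr_ae h1, lintegral_lintegral_swap]
  · apply lintegral_congr
    intro r
    rw [← lintegral_indicator Metric.isClosed_closedBall.measurableSet, ← lintegral_const_mul'']
    · apply lintegral_congr_ae
      filter_upwards [hf.ae_eq_mk] with z hz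
      simp only [Set.indicator, Set.mem_ofPred_eq, Metric.mem_closedBall, dist_eq_norm, hz]
      split_ifs <;> simp [mul_comm]
    · exact hf.indicator Metric.isClosed_closedBall.measurableSet
  · apply Measurable.aemeasurable
    have := hf.measurable_mk
    exact Measurable.indicator (by fun_prop) hms

/-- A kernel decaying like `|w|^{-d-c}` away from the scale `A` is controlled by the maximal
function. -/
lemma lintegral_mul_max_rpow_le (μ : Measure E) [μ.IsAddHaarMeasure]
    {f : E → ℝ≥0∞} (hf : AEMeasurable f μ) (x : E) {A c : ℝ}
    (hA : 0 < A) (hc : 0 < c) :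
    ∫⁻ z, f z * ENNReal.ofReal ((max ‖z - x‖ A) ^ (-(Module.finrank ℝ E + c))) ∂μ ≤
      ENNReal.ofReal (2 ^ Module.finrank ℝ E * ((Module.finrank ℝ E + c) / c) * A ^ (-c)) *
        μ (Metric.ball 0 1) * maximalFn μ f x := by
  set d := Module.finrank ℝ E
  have hdc : 0 < (d : ℝ) + c := by positivity
  -- Minus the derivative of `r ^ (-(d + c))`, cut off at `A`: its integral over `r ≥ ‖z - x‖` is
  -- the kernel. Against the ball growth `r ^ d` it leaves `r ^ (-c - 1)`, integrable at infinity.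
  set m : ℝ → ℝ≥0∞ := Set.indicator (Set.Ioi A)
    (fun r => ENNReal.ofReal (((d : ℝ) + c) * r ^ (-((d : ℝ) + c) - 1))) with hm_def
  have hm : Measurable m := Measurable.indicator (by fun_prop) measurableSet_Ioi
  rw [mul_assoc]
  have hball : ∀ r : ℝ, 0 < r → ∫⁻ z in Metric.closedBall x r, f z ∂μ ≤
      ENNReal.ofReal ((2 * r) ^ d) * (μ (Metric.ball 0 1) * maximalFn μ f x) := fun r hr => by
    rw [← mul_assoc]; exact lintegral_closedBall_le_maximalFn f x hr
  generalize μ (Metric.ball 0 1) * maximalFn μ f x = B at hball ⊢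
  calc ∫⁻ z, f z * ENNReal.ofReal ((max ‖z - x‖ A) ^ (-((d : ℝ) + c))) ∂μ
      ≤ ∫⁻ z, f z * (∫⁻ r in Set.Ici ‖z - x‖, m r) ∂μ := by
        apply lintegral_mono
        intro z
        dsimp only
        gcongr
        rw [← setLIntegral_Ioi_rpow_eq (lt_max_of_lt_right hA) hdc, hm_def,
          setLIntegral_indicator measurableSet_Ioi]
        apply lintegral_mono_set
        intro r hr
        have := max_lt_iff.1 (Set.mem_Ioi.1 hr)
        exact ⟨this.2, this.1.le⟩
    _ = ∫⁻ r, m r * ∫⁻ z in Metric.closedBall x r, f z ∂μ :=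
        lintegral_mul_setLIntegral_Ici hf x hm
    _ ≤ ∫⁻ r, Set.indicator (Set.Ioi A) (fun r => ENNReal.ofReal (c * r ^ (-c - 1)) *
          (ENNReal.ofReal (2 ^ d * ((d + c) / c)) * B)) r := by
        apply lintegral_mono
        intro r
        by_cases hr : A < r
        · have hr0 : 0 < r := hA.trans hr
          simp only [hm_def, Set.indicator, Set.mem_Ioi, hr, if_true]
          calc _ ≤ _ := mul_le_mul_right (hball r hr0) _
            _ = _ := by
              rw [← mul_assoc, ← mul_assoc,
                ← ENNReal.ofReal_mul (by positivity), ← ENNReal.ofReal_mul (by positivity)]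
              congr 2
              rw [show -((d : ℝ) + c) - 1 = (-c - 1) - d by ring, Real.rpow_sub_natCast hr0.ne',
                mul_pow]
              field_simp
        · simp [hm_def, Set.indicator, hr]
    _ = _ := by
        rw [lintegral_indicator measurableSet_Ioi, lintegral_mul_const _ (by fun_prop),
          setLIntegral_Ioi_rpow_eq hA hc, ← mul_assoc, ← ENNReal.ofReal_mul (by positivity),
          mul_comm (A ^ (-c))]

/-- The locally integrable kernel `|w|^{β-d}` on the ball of radius `A` is controlled by the
maximal function. -/
lemma setLIntegral_mul_norm_rpow_le (μ : Measure E) [μ.IsAddHaarMeasure]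
    {f : E → ℝ≥0∞} (hf : AEMeasurable f μ) (x : E) {A β : ℝ}
    (hA : 0 < A) (hβ : 0 < β) (hβd : β < Module.finrank ℝ E) :
    ∫⁻ z in Metric.closedBall x A, f z *
        ENNReal.ofReal (‖z - x‖ ^ (-(Module.finrank ℝ E - β))) ∂μ ≤
      ENNReal.ofReal (2 ^ Module.finrank ℝ E * (Module.finrank ℝ E / β) * A ^ β) *
        μ (Metric.ball 0 1) * maximalFn μ f x := by
  set d := Module.finrank ℝ E
  have hdb : 0 < (d : ℝ) - β := by linarith
  set m : ℝ → ℝ≥0∞ := Set.indicator (Set.Ioi 0)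
    (fun r => ENNReal.ofReal (((d : ℝ) - β) * r ^ (-((d : ℝ) - β) - 1))) with hm_def
  have hm : Measurable m := Measurable.indicator (by fun_prop) measurableSet_Ioi
  -- Truncating `f` freezes the ball integrals at radius `A`. Radii below `A` then contribute `∫ r ^
  -- (β - 1)` near zero, and radii above `A` the tail of `m` times `A ^ d`.
  set F : E → ℝ≥0∞ := Set.indicator (Metric.closedBall x A) f with hF
  have hFm : AEMeasurable F μ := hf.indicator Metric.isClosed_closedBall.measurableSet
  rw [mul_assoc]
  have hball : ∀ r : ℝ, 0 < r → ∫⁻ z in Metric.closedBall x r, f z ∂μ ≤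
      ENNReal.ofReal ((2 * r) ^ d) * (μ (Metric.ball 0 1) * maximalFn μ f x) := fun r hr => by
    rw [← mul_assoc]; exact lintegral_closedBall_le_maximalFn f x hr
  generalize μ (Metric.ball 0 1) * maximalFn μ f x = B at hball ⊢
  calc ∫⁻ z in Metric.closedBall x A, f z * ENNReal.ofReal (‖z - x‖ ^ (-((d : ℝ) - β))) ∂μ
      = ∫⁻ z, F z * ENNReal.ofReal (‖z - x‖ ^ (-((d : ℝ) - β))) ∂μ := by
        rw [← lintegral_indicator Metric.isClosed_closedBall.measurableSet]
        apply lintegral_congr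
        intro z
        simp [hF, Set.indicator]
    _ ≤ ∫⁻ z, F z * (∫⁻ r in Set.Ici ‖z - x‖, m r) ∂μ := by
        apply lintegral_mono
        intro z
        dsimp only
        gcongr
        rcases (norm_nonneg (z - x)).eq_or_lt with h0 | h0
        -- At `z = x` the kernel is not infinite: a real power of `0` with nonzero exponent is `0`.
        · rw [← h0, Real.zero_rpow (by linarith), ENNReal.ofReal_zero]
          exact zero_le
        · rw [← setLIntegral_Ioi_rpow_eq h0 hdb, hm_def,
            setLIntegral_indicator measurableSet_Ioi]
          apply lintegral_mono_set
          intro r hr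
          exact ⟨h0.trans hr, (Set.mem_Ioi.1 hr).le⟩
    _ = ∫⁻ r, m r * ∫⁻ z in Metric.closedBall x r, F z ∂μ :=
        lintegral_mul_setLIntegral_Ici hFm x hm
    _ ≤ ∫⁻ r, (Set.indicator (Set.Ioo 0 A) (fun r => ENNReal.ofReal (β * r ^ (β - 1)) *
          (ENNReal.ofReal (2 ^ d * ((d - β) / β)) * B)) r +
          Set.indicator (Set.Ici A) (fun r => ENNReal.ofReal ((d - β) * r ^ (-((d : ℝ) - β) - 1)) *
          (ENNReal.ofReal (2 ^ d * A ^ d) * B)) r) := by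
        apply lintegral_mono
        intro r
        dsimp only
        by_cases hr0 : 0 < r
        · by_cases hr : r < A
          · have hr' : ¬ A ≤ r := not_le.2 hr
            simp only [hm_def, Set.indicator, Set.mem_Ioi, Set.mem_Ioo, Set.mem_Ici, hr0, hr,
              hr', and_self, if_true, if_false, add_zero]
            calc _ ≤ ENNReal.ofReal (((d : ℝ) - β) * r ^ (-((d : ℝ) - β) - 1)) *
                    ∫⁻ z in Metric.closedBall x r, f z ∂μ := by
                  gcongr
                  exact Set.indicator_le_self _ _ _
              _ ≤ _ := mul_le_mul_right (hball r hr0) _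
              _ = _ := by
                rw [← mul_assoc, ← mul_assoc,
                  ← ENNReal.ofReal_mul (by positivity), ← ENNReal.ofReal_mul (by positivity)]
                congr 2
                rw [show -((d : ℝ) - β) - 1 = (β - 1) - d by ring, Real.rpow_sub_natCast hr0.ne',
                  mul_pow]
                field_simp
          · have hr' : A ≤ r := not_lt.1 hr
            simp only [hm_def, Set.indicator, Set.mem_Ioi, Set.mem_Ioo, Set.mem_Ici, hr0, hr,
              hr', and_false, if_true, if_false, zero_add]
            gcongr
            calc ∫⁻ z in Metric.closedBall x r, F z ∂μ ≤ ∫⁻ z, F z ∂μ :=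
                  setLIntegral_le_lintegral _ _
              _ = ∫⁻ z in Metric.closedBall x A, f z ∂μ :=
                  lintegral_indicator Metric.isClosed_closedBall.measurableSet _
              _ ≤ _ := hball A hA
              _ = _ := by rw [mul_pow]
        · simp [hm_def, Set.indicator, hr0]
    _ = _ := by
        rw [lintegral_add_left (Measurable.indicator (by fun_prop) measurableSet_Ioo),
          lintegral_indicator measurableSet_Ioo, lintegral_indicator measurableSet_Ici,
          lintegral_mul_const _ (by fun_prop), lintegral_mul_const _ (by fun_prop),
          setLIntegral_congr Ioi_ae_eq_Ici.symm,
          setLIntegral_Ioi_rpow_eq hA hdb, setLIntegral_rpow_sub_one_eq hA.le hβ,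
          ← mul_assoc, ← mul_assoc, ← ENNReal.ofReal_mul (by positivity),
          ← ENNReal.ofReal_mul (by positivity), ← add_mul,
          ← ENNReal.ofReal_add (by positivity) (by positivity)]
        congr 2
        rw [show -((d : ℝ) - β) = β - d by ring, Real.rpow_sub_natCast hA.ne']
        field_simp
        ring

end Kernels

/-! ### Dilated Schwartz functions and the Littlewood–Paley kernel. -/

section TestFunctions

variable {n : ℕ}

/-- The Schwartz function `z ↦ φ (R (z - x))`. -/
noncomputable def SchwartzMap.dilateAt (φ : 𝓢(EuclideanSpace ℝ (Fin n), ℂ)) {R : ℝ} (hR : R ≠ 0)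
    (x : EuclideanSpace ℝ (Fin n)) : 𝓢(EuclideanSpace ℝ (Fin n), ℂ) :=
  SchwartzMap.compSubConstCLM ℂ x (SchwartzMap.compCLMOfContinuousLinearEquiv ℂ
    (ContinuousLinearEquiv.smulLeft (Units.mk0 R hR)) φ)

lemma SchwartzMap.dilateAt_apply (φ : 𝓢(EuclideanSpace ℝ (Fin n), ℂ)) {R : ℝ} (hR : R ≠ 0)
    (x z : EuclideanSpace ℝ (Fin n)) : φ.dilateAt hR x z = φ (R • (z - x)) := rfl

lemma fourier_comp_smul_sub (f : EuclideanSpace ℝ (Fin n) → ℂ) {R : ℝ} (hR : 0 < R)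
    (x ξ : EuclideanSpace ℝ (Fin n)) :
    𝓕 (fun z => f (R • (z - x))) ξ =
      ((R ^ n)⁻¹ : ℝ) * (Complex.exp (↑(-2 * Real.pi * inner ℝ x ξ) * Complex.I) *
        𝓕 f (R⁻¹ • ξ)) := by
  rw [Real.fourier_eq', Real.fourier_eq', ← integral_add_right_eq_self _ x]
  have h := Measure.integral_comp_smul (volume : Measure (EuclideanSpace ℝ (Fin n)))
    (fun w => Complex.exp (↑(-2 * Real.pi * inner ℝ (R⁻¹ • w + x) ξ) * Complex.I) • f w) R
  simp only [inv_smul_smul₀ hR.ne'] at h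
  simp only [add_sub_cancel_right]
  rw [h, ← integral_const_mul, finrank_euclideanSpace_fin, abs_of_pos (by positivity),
    Complex.real_smul]
  congr 2
  ext w
  rw [smul_eq_mul, smul_eq_mul, ← mul_assoc, ← Complex.exp_add]
  congr 2
  rw [inner_add_left, real_inner_smul_left, real_inner_smul_right]
  push_cast
  ring

/-- In the frequency variable, the factor `R ^ (-n)` from dilating cancels the Jacobian of `ξ ↦ R⁻¹
• ξ`, and homogeneity of `‖ξ‖ ^ s` leaves `R ^ s`. -/
lemma fracDerivSchwartz_dilateAt (s : ℝ) (φ : 𝓢(EuclideanSpace ℝ (Fin n), ℂ)) {R : ℝ}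
    (hR : 0 < R) (x z : EuclideanSpace ℝ (Fin n)) :
    fracDerivSchwartz s (φ.dilateAt hR.ne' x) z =
      ((R ^ s : ℝ) : ℂ) * fracDerivSchwartz s φ (R • (z - x)) := by
  have h0 : ⇑(φ.dilateAt hR.ne' x) = fun z => φ (R • (z - x)) := rfl
  unfold fracDerivSchwartz
  rw [h0, Real.fourierInv_eq', Real.fourierInv_eq']
  simp only [fourier_comp_smul_sub _ hR]
  set G : EuclideanSpace ℝ (Fin n) → ℂ := fun η =>
      (Complex.exp (↑(2 * Real.pi * inner ℝ η (R • (z - x))) * Complex.I) •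
      (((‖η‖ ^ s : ℝ) : ℂ) * 𝓕 (φ : EuclideanSpace ℝ (Fin n) → ℂ) η)) with hG
  have h := Measure.integral_comp_smul (volume : Measure (EuclideanSpace ℝ (Fin n)))
    (fun η => ((R ^ n)⁻¹ : ℝ) * ((R ^ s : ℝ) : ℂ) * G η) R⁻¹
  rw [integral_const_mul _ G, finrank_euclideanSpace_fin, abs_of_pos (by positivity),
    Complex.real_smul] at h
  have h2 : (((R⁻¹ ^ n)⁻¹ : ℝ) : ℂ) * ((((R ^ n)⁻¹ : ℝ) : ℂ) * ((R ^ s : ℝ) : ℂ)) =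
      ((R ^ s : ℝ) : ℂ) := by
    rw [← mul_assoc, ← Complex.ofReal_mul]
    have : (R⁻¹ ^ n)⁻¹ * (R ^ n)⁻¹ = 1 := by
      rw [inv_pow, inv_inv]
      exact mul_inv_cancel₀ (by positivity)
    rw [this, Complex.ofReal_one, one_mul]
  rw [← mul_assoc, h2] at h
  rw [← h]
  congr 1
  ext ξ
  have h3 : ‖ξ‖ ^ s = R ^ s * ‖R⁻¹ • ξ‖ ^ s := by
    rw [norm_smul, norm_inv, Real.norm_of_nonneg hR.le, Real.mul_rpow (by positivity)
      (by positivity), Real.inv_rpow hR.le, mul_inv_cancel_left₀ (by positivity)]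
  have h4 : Complex.exp (↑(2 * Real.pi * inner ℝ ξ z) * Complex.I) *
      Complex.exp (↑(-2 * Real.pi * inner ℝ x ξ) * Complex.I) =
      Complex.exp (↑(2 * Real.pi * inner ℝ (R⁻¹ • ξ) (R • (z - x))) * Complex.I) := by
    rw [← Complex.exp_add]
    congr 1
    rw [real_inner_smul_left, real_inner_smul_right, inner_sub_right, real_inner_comm x ξ,
      inv_mul_cancel_left₀ hR.ne']
    push_cast
    ring
  simp only [hG]
  rw [h3, ← h4]
  simp only [smul_eq_mul]
  push_cast
  ring

/-- Rapid decay of a Schwartz function and of its increments. -/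
lemma SchwartzMap.exists_decay (φ : 𝓢(EuclideanSpace ℝ (Fin n), ℂ)) (N : ℕ) :
    ∃ B : ℝ, 0 < B ∧ (∀ w, ‖φ w‖ ≤ B * ((1 + ‖w‖) ^ N)⁻¹) ∧
      ∀ w w', ‖w' - w‖ ≤ 1 → ‖φ w' - φ w‖ ≤ B * ‖w' - w‖ * ((1 + ‖w‖) ^ N)⁻¹ := by
  set S := 2 ^ N * ((Finset.Iic (N, 1)).sup fun m => SchwartzMap.seminorm ℝ m.1 m.2) φ with hS
  have hS0 : 0 ≤ S := by positivity
  have h0 : ∀ w, ‖φ w‖ ≤ S * ((1 + ‖w‖) ^ N)⁻¹ := by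
    intro w
    have := SchwartzMap.one_add_le_sup_seminorm_apply (𝕜 := ℝ) (m := (N, 1)) (k := N) (n := 0)
      le_rfl zero_le_one φ w
    rw [norm_iteratedFDeriv_zero] at this
    rw [← div_eq_mul_inv, le_div_iff₀' (by positivity)]
    exact this
  have h1 : ∀ w, ‖fderiv ℝ φ w‖ ≤ S * ((1 + ‖w‖) ^ N)⁻¹ := by
    intro w
    have := SchwartzMap.one_add_le_sup_seminorm_apply (𝕜 := ℝ) (m := (N, 1)) (k := N) (n := 1)
      le_rfl le_rfl φ w
    rw [norm_iteratedFDeriv_one] at this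
    rw [← div_eq_mul_inv, le_div_iff₀' (by positivity)]
    exact this
  have hpow : (1 : ℝ) ≤ 2 ^ N := one_le_pow₀ one_le_two
  refine ⟨2 ^ N * (S + 1), by positivity, fun w => (h0 w).trans ?_, fun w w' hww => ?_⟩
  · gcongr
    nlinarith
  · have hc : ∀ v ∈ Metric.closedBall w 1, ‖fderiv ℝ φ v‖ ≤
        2 ^ N * (S + 1) * ((1 + ‖w‖) ^ N)⁻¹ := by
      intro v hv
      rw [Metric.mem_closedBall, dist_eq_norm] at hv
      -- Within distance one the weights are comparable, so the derivative bound is uniform on the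
      -- ball and the mean value inequality applies.
      have h2 : 1 + ‖w‖ ≤ 2 * (1 + ‖v‖) := by
        have := norm_sub_norm_le w v
        rw [norm_sub_rev] at this
        linarith [norm_nonneg v]
      have h3 : ((1 + ‖v‖) ^ N)⁻¹ ≤ 2 ^ N * ((1 + ‖w‖) ^ N)⁻¹ := by
        rw [← div_eq_mul_inv, le_div_iff₀ (by positivity), ← div_eq_inv_mul,
          div_le_iff₀ (by positivity), ← mul_pow]
        gcongr
      calc ‖fderiv ℝ φ v‖ ≤ S * ((1 + ‖v‖) ^ N)⁻¹ := h1 v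
        _ ≤ (S + 1) * (2 ^ N * ((1 + ‖w‖) ^ N)⁻¹) := by gcongr; linarith
        _ = _ := by ring
    have := (convex_closedBall w 1).norm_image_sub_le_of_norm_fderiv_le (𝕜 := ℝ)
      (fun v _ => φ.differentiableAt) hc (Metric.mem_closedBall_self zero_le_one)
      (by rwa [Metric.mem_closedBall, dist_eq_norm] : w' ∈ Metric.closedBall w 1)
    calc _ ≤ _ := this
      _ = _ := by ring

/-- A Schwartz function with integral one, such that the difference of two consecutive dyadic
dilations is a fractional derivative of a Schwartz function. -/
lemma exists_littlewoodPaley_kernel (n : ℕ) (s : ℝ) :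
    ∃ χ θ : 𝓢(EuclideanSpace ℝ (Fin n), ℂ), ∫ z, χ z = 1 ∧
      ∀ w, fracDerivSchwartz s θ w = (2 : ℂ) ^ n * χ ((2 : ℝ) • w) - χ w := by
  let b : ContDiffBump (0 : EuclideanSpace ℝ (Fin n)) := ⟨1, 2, one_pos, one_lt_two⟩
  have hbs : ContDiff ℝ ((⊤ : ℕ∞) : WithTop ℕ∞) (fun ξ => (b ξ : ℂ)) :=
    Complex.ofRealCLM.contDiff.comp b.contDiff
  have hbc : HasCompactSupport (fun ξ => (b ξ : ℂ)) :=
    b.hasCompactSupport.comp_left (g := fun x : ℝ => (x : ℂ)) Complex.ofReal_zero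
  let bS : 𝓢(EuclideanSpace ℝ (Fin n), ℂ) := hbc.toSchwartzMap hbs
  let b2S : 𝓢(EuclideanSpace ℝ (Fin n), ℂ) := bS.dilateAt (R := 1 / 2) (by norm_num) 0
  have hb2 : ∀ ξ, b2S ξ = (b ((1 / 2 : ℝ) • ξ) : ℂ) := fun ξ => by
    simp only [b2S, SchwartzMap.dilateAt_apply, sub_zero]
    rfl
  have hb1 : ∀ ξ, bS ξ = (b ξ : ℂ) := fun ξ => rfl
  -- With `χ` the inverse transform of the bump `b`, the function `2 ^ n χ (2 w) - χ w` has
  -- transform `b (ξ / 2) - b ξ`. This vanishes on the unit ball, so dividing by `‖ξ‖ ^ s` creates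
  -- no singularity and `m` is again a Schwartz function.
  let m : EuclideanSpace ℝ (Fin n) → ℂ := fun ξ => ((‖ξ‖ ^ (-s) : ℝ) : ℂ) * (b2S ξ - bS ξ)
  have hm0 : ∀ ξ, ‖ξ‖ ≤ 1 → b2S ξ - bS ξ = 0 := by
    intro ξ hξ
    rw [hb1, hb2, b.one_of_mem_closedBall, b.one_of_mem_closedBall, sub_self]
    · simpa [b] using hξ
    · simp only [Metric.mem_closedBall, dist_zero_right, norm_smul, b]
      norm_num
      linarith
  have hmc : HasCompactSupport m := by
    have h2 : HasCompactSupport (fun ξ => b2S ξ) := by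
      have : (fun ξ => b2S ξ) = fun ξ => (fun ξ => (b ξ : ℂ)) ((1 / 2 : ℝ) • ξ) := funext hb2
      rw [this]
      exact hbc.comp_smul (by norm_num)
    exact (h2.sub hbc).mul_left
  have hms : ContDiff ℝ ((⊤ : ℕ∞) : WithTop ℕ∞) m := by
    rw [contDiff_iff_contDiffAt]
    intro ξ
    by_cases hξ : ξ = 0
    · subst hξ
      apply (contDiffAt_const (c := (0 : ℂ))).congr_of_eventuallyEq
      filter_upwards [Metric.closedBall_mem_nhds (0 : EuclideanSpace ℝ (Fin n)) one_pos] with ξ hξ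
      simp only [m]
      rw [hm0 ξ (by simpa using hξ), mul_zero]
    · apply ContDiffAt.mul
      · exact Complex.ofRealCLM.contDiff.contDiffAt.comp ξ
          ((contDiffAt_norm ℝ hξ).rpow_const_of_ne (norm_ne_zero_iff.2 hξ))
      · exact ((b2S.smooth ⊤).sub (bS.smooth ⊤)).contDiffAt
  let mS : 𝓢(EuclideanSpace ℝ (Fin n), ℂ) := hmc.toSchwartzMap hms
  refine ⟨𝓕⁻ bS, 𝓕⁻ mS, ?_, ?_⟩
  · have h1 : 𝓕 (𝓕⁻ bS) = bS := by simp
    have h2 : (𝓕 (𝓕⁻ bS)) 0 = 1 := by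
      rw [h1, hb1, b.one_of_mem_closedBall (Metric.mem_closedBall_self b.rIn_pos.le)]
      simp
    rw [SchwartzMap.fourier_coe, Real.fourier_eq'] at h2
    simpa using h2
  · intro w
    have h1 : 𝓕 (𝓕⁻ mS) = mS := by simp
    have h2 : (fun ξ : EuclideanSpace ℝ (Fin n) =>
        ((‖ξ‖ ^ s : ℝ) : ℂ) * 𝓕 ((𝓕⁻ mS : 𝓢(EuclideanSpace ℝ (Fin n), ℂ)) :
          EuclideanSpace ℝ (Fin n) → ℂ) ξ) = ⇑(b2S - bS) := by
      ext ξ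
      rw [← SchwartzMap.fourier_coe, h1]
      change _ * m ξ = b2S ξ - bS ξ
      simp only [m]
      by_cases hξ : ‖ξ‖ ≤ 1
      · rw [hm0 ξ hξ]; simp
      · have : 0 < ‖ξ‖ := by linarith
        rw [← mul_assoc, ← Complex.ofReal_mul, ← Real.rpow_add this]
        simp
    unfold fracDerivSchwartz
    rw [h2, ← SchwartzMap.fourierInv_coe]
    have h3 : 𝓕⁻ (b2S - bS) = 𝓕⁻ b2S - 𝓕⁻ bS := by
      rw [sub_eq_add_neg, ← neg_one_smul ℂ bS, FourierTransform.fourierInv_add,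
        FourierTransform.fourierInv_smul]
      simp [sub_eq_add_neg]
    rw [h3, sub_apply]
    congr 1
    rw [SchwartzMap.fourierInv_coe, SchwartzMap.fourierInv_coe, Real.fourierInv_eq_fourier_neg,
      Real.fourierInv_eq_fourier_neg]
    have h4 : ⇑b2S = fun z => bS ((1 / 2 : ℝ) • (z - 0)) := rfl
    rw [h4, fourier_comp_smul_sub _ (by norm_num)]
    simp

end TestFunctions

/-! ### Convolution bounds at scale `t`. -/

section PoissonBounds

variable {n : ℕ}

lemma exists_lintegral_mul_max_rpow_le (n : ℕ) {c : ℝ} (hc : 0 < c) :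
    ∃ C : ℝ≥0, ∀ f : EuclideanSpace ℝ (Fin n) → ℝ≥0∞, AEMeasurable f volume → ∀
        (x : EuclideanSpace ℝ (Fin n)) (A : ℝ), 0 < A →
      ∫⁻ z, f z * ENNReal.ofReal ((max ‖z - x‖ A) ^ (-((n : ℝ) + c))) ≤
        C * ENNReal.ofReal (A ^ (-c)) * maximalFn volume f x := by
  refine ⟨(ENNReal.ofReal (2 ^ n * ((n + c) / c)) * volume
      (Metric.ball (0 : EuclideanSpace ℝ (Fin n)) 1)).toNNReal,
    fun f hf x A hA => ?_⟩
  have h := lintegral_mul_max_rpow_le volume hf x hA hc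
  rw [finrank_euclideanSpace_fin] at h
  refine h.trans_eq ?_
  rw [ENNReal.coe_toNNReal (ENNReal.mul_ne_top ENNReal.ofReal_ne_top measure_ball_lt_top.ne),
    ENNReal.ofReal_mul (by positivity)]
  ring

lemma exists_setLIntegral_mul_norm_rpow_le (n : ℕ) {β : ℝ} (hβ : 0 < β) (hβn : β < n) :
    ∃ C : ℝ≥0, ∀ f : EuclideanSpace ℝ (Fin n) → ℝ≥0∞, AEMeasurable f volume → ∀
        (x : EuclideanSpace ℝ (Fin n)) (A : ℝ), 0 < A →
      ∫⁻ z in Metric.closedBall x A, f z * ENNReal.ofReal (‖z - x‖ ^ (-((n : ℝ) - β))) ≤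
        C * ENNReal.ofReal (A ^ β) * maximalFn volume f x := by
  refine ⟨(ENNReal.ofReal (2 ^ n * (n / β)) * volume
      (Metric.ball (0 : EuclideanSpace ℝ (Fin n)) 1)).toNNReal,
    fun f hf x A hA => ?_⟩
  have h := setLIntegral_mul_norm_rpow_le volume hf x hA hβ
    (by rwa [finrank_euclideanSpace_fin])
  rw [finrank_euclideanSpace_fin] at h
  refine h.trans_eq ?_
  rw [ENNReal.coe_toNNReal (ENNReal.mul_ne_top ENNReal.ofReal_ne_top measure_ball_lt_top.ne),
    ENNReal.ofReal_mul (by positivity)]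
  ring

lemma inv_one_add_norm_pow_le {t : ℝ} (ht : 0 < t) (w : EuclideanSpace ℝ (Fin n)) (N : ℕ) :
    ((1 + ‖t⁻¹ • w‖) ^ N)⁻¹ ≤ t ^ N * (max ‖w‖ t) ^ (-(N : ℝ)) := by
  have hm : 0 < max ‖w‖ t := lt_max_of_lt_right ht
  rw [Real.rpow_neg hm.le, Real.rpow_natCast, ← div_eq_mul_inv, ← inv_div, ← div_pow]
  apply inv_anti₀ (by positivity)
  gcongr
  rw [norm_smul, norm_inv, Real.norm_of_nonneg ht.le, div_le_iff₀ ht, add_mul, one_mul,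
    mul_comm t⁻¹, inv_mul_cancel_right₀ ht.ne']
  exact max_le (by linarith) (by linarith [norm_nonneg w])

/-- Decay of order `n + 1` suffices: it is the case `c = 1` of the kernel estimate. The increment
bound gains `‖x - y‖ / t`, which makes the sum over large scales converge. -/
lemma SchwartzMap.exists_enorm_dilate_le (φ : 𝓢(EuclideanSpace ℝ (Fin n), ℂ)) :
    ∃ B : ℝ≥0, ∀ (t : ℝ), 0 < t → ∀ x z : EuclideanSpace ℝ (Fin n),
      ‖φ (t⁻¹ • (z - x))‖ₑ ≤ B * ENNReal.ofReal (t ^ (n + 1)) *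
        ENNReal.ofReal ((max ‖z - x‖ t) ^ (-((n : ℝ) + 1))) ∧
      ∀ y, ‖x - y‖ ≤ t → ‖φ (t⁻¹ • (z - x)) - φ (t⁻¹ • (z - y))‖ₑ ≤
        B * ENNReal.ofReal (‖x - y‖ * t ^ n) *
          ENNReal.ofReal ((max ‖z - x‖ t) ^ (-((n : ℝ) + 1))) := by
  obtain ⟨B, hB, h1, h2⟩ := φ.exists_decay (n + 1)
  refine ⟨B.toNNReal, fun t ht x z => ⟨?_, fun y hxy => ?_⟩⟩
  · rw [← ENNReal.ofReal, ← ENNReal.ofReal_mul hB.le, ← ENNReal.ofReal_mul (by positivity),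
      ← ofReal_norm]
    apply ENNReal.ofReal_le_ofReal
    calc _ ≤ _ := h1 _
      _ ≤ B * (t ^ (n + 1) * (max ‖z - x‖ t) ^ (-((n + 1 : ℕ) : ℝ))) := by
        gcongr
        exact inv_one_add_norm_pow_le ht _ _
      _ = _ := by push_cast; ring
  · rw [← ENNReal.ofReal, ← ENNReal.ofReal_mul hB.le, ← ENNReal.ofReal_mul (by positivity),
      ← ofReal_norm, norm_sub_rev]
    apply ENNReal.ofReal_le_ofReal
    have hd : ‖t⁻¹ • (z - y) - t⁻¹ • (z - x)‖ = ‖x - y‖ / t := by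
      rw [← smul_sub, norm_smul, norm_inv, Real.norm_of_nonneg ht.le, sub_sub_sub_cancel_left,
        div_eq_inv_mul]
    calc _ ≤ _ := h2 (t⁻¹ • (z - x)) (t⁻¹ • (z - y)) (by
            rw [hd, div_le_one ht]; exact hxy)
      _ ≤ B * (‖x - y‖ / t) * (t ^ (n + 1) * (max ‖z - x‖ t) ^ (-((n + 1 : ℕ) : ℝ))) := by
        rw [hd]
        gcongr
        exact inv_one_add_norm_pow_le ht _ _
      _ = _ := by
        push_cast
        rw [pow_succ]
        field_simp

/-- Convolutions with dilated Schwartz functions are controlled by the maximal function. -/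
lemma SchwartzMap.exists_lintegral_dilate_le (φ : 𝓢(EuclideanSpace ℝ (Fin n), ℂ)) :
    ∃ C : ℝ≥0, ∀ f : EuclideanSpace ℝ (Fin n) → ℝ≥0∞, AEMeasurable f volume → ∀ (t : ℝ), 0 < t →
        ∀ x : EuclideanSpace ℝ (Fin n),
      ∫⁻ z, f z * ‖φ (t⁻¹ • (z - x))‖ₑ ≤
        C * ENNReal.ofReal (t ^ n) * maximalFn volume f x ∧
      ∀ y, ‖x - y‖ ≤ t → ∫⁻ z, f z * ‖φ (t⁻¹ • (z - x)) - φ (t⁻¹ • (z - y))‖ₑ ≤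
        C * ENNReal.ofReal (‖x - y‖ * t ^ n / t) * maximalFn volume f x := by
  obtain ⟨B, hB⟩ := φ.exists_enorm_dilate_le
  obtain ⟨C, hC⟩ := exists_lintegral_mul_max_rpow_le n one_pos
  have key : ∀ (f : EuclideanSpace ℝ (Fin n) → ℝ≥0∞), AEMeasurable f volume → ∀ (t : ℝ), 0 < t →
      ∀ x : EuclideanSpace ℝ (Fin n),
      ∀ (a : ℝ≥0∞) (k : EuclideanSpace ℝ (Fin n) → ℝ≥0∞), a ≠ ∞ → (∀ z, k z ≤ a *
        ENNReal.ofReal ((max ‖z - x‖ t) ^ (-((n : ℝ) + 1)))) →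
      ∫⁻ z, f z * k z ≤ a * (C * ENNReal.ofReal (t ^ (-1 : ℝ)) * maximalFn volume f x) := by
    intro f hf t ht x a k ha hk
    calc ∫⁻ z, f z * k z ≤
        ∫⁻ z, a * (f z * ENNReal.ofReal ((max ‖z - x‖ t) ^ (-((n : ℝ) + 1)))) := by
          apply lintegral_mono
          intro z
          dsimp only
          rw [mul_left_comm]
          gcongr
          exact hk z
      _ = a * ∫⁻ z, f z * ENNReal.ofReal ((max ‖z - x‖ t) ^ (-((n : ℝ) + 1))) :=
          lintegral_const_mul' _ _ ha
      _ ≤ _ := by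
          gcongr
          exact hC f hf x t ht
  refine ⟨B * C, fun f hf t ht x => ⟨?_, fun y hxy => ?_⟩⟩
  · refine (key f hf t ht x (B * ENNReal.ofReal (t ^ (n + 1))) _
      (ENNReal.mul_ne_top ENNReal.coe_ne_top ENNReal.ofReal_ne_top)
      (fun z => (hB t ht x z).1)).trans_eq ?_
    rw [show t ^ n = t ^ (n + 1) * t ^ (-1 : ℝ) by
      rw [Real.rpow_neg_one, pow_succ]; field_simp, ENNReal.ofReal_mul (by positivity)]
    push_cast
    ring
  · refine (key f hf t ht x (B * ENNReal.ofReal (‖x - y‖ * t ^ n)) _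
      (ENNReal.mul_ne_top ENNReal.coe_ne_top ENNReal.ofReal_ne_top)
      (fun z => (hB t ht x z).2 y hxy)).trans_eq ?_
    rw [div_eq_mul_inv, ← Real.rpow_neg_one t, ENNReal.ofReal_mul (q := t ^ (-1 : ℝ))
      (by positivity)]
    push_cast
    ring

end PoissonBounds

/-! ### Functions integrable against a power weight. -/

section Weighted

variable {n : ℕ}

lemma one_add_norm_rpow_mul_cancel (c : ℝ) (u : EuclideanSpace ℝ (Fin n) → ℂ)
    (x : EuclideanSpace ℝ (Fin n)) :
    (((1 + ‖x‖) ^ c : ℝ) : ℂ) * ((((1 + ‖x‖) ^ (-c) : ℝ) : ℂ) * u x) = u x := by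
  have : 0 < 1 + ‖x‖ := by positivity
  rw [← mul_assoc, ← Complex.ofReal_mul, ← Real.rpow_add this, add_neg_cancel, Real.rpow_zero,
    Complex.ofReal_one, one_mul]

lemma continuous_one_add_norm_rpow (c : ℝ) :
    Continuous fun x : EuclideanSpace ℝ (Fin n) => (((1 + ‖x‖) ^ c : ℝ) : ℂ) := by
  apply Complex.continuous_ofReal.comp
  apply Continuous.rpow_const (by fun_prop)
  intro x
  left
  positivity

lemma locallyIntegrable_of_weighted {c : ℝ} {u : EuclideanSpace ℝ (Fin n) → ℂ}
    (hu : Integrable (fun x => (((1 + ‖x‖) ^ (-c) : ℝ) : ℂ) * u x) volume) :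
    LocallyIntegrable u volume := by
  have := hu.locallyIntegrable.continuous_smul (continuous_one_add_norm_rpow (n := n) c)
  exact (this.congr (Filter.Eventually.of_forall fun x => one_add_norm_rpow_mul_cancel c u x))

lemma lintegral_weighted_ne_top {c : ℝ} {u : EuclideanSpace ℝ (Fin n) → ℂ}
    (hu : Integrable (fun x => (((1 + ‖x‖) ^ (-c) : ℝ) : ℂ) * u x) volume) :
    ∫⁻ z, ‖u z‖ₑ * ENNReal.ofReal ((1 + ‖z‖) ^ (-c)) ≠ ∞ := by
  have := hu.2.ne
  convert this using 3 with z
  rw [enorm_mul, mul_comm]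
  congr 1
  rw [← ofReal_norm, Complex.norm_real, Real.norm_of_nonneg (by positivity)]

/-- Moves the centre of the kernel from `x` to the origin, at a cost depending on `x` and `A`; used
only for finiteness, never for uniform bounds. -/
lemma max_rpow_le_one_add_norm_rpow {a : ℝ} (ha : 0 < a) (x z : EuclideanSpace ℝ (Fin n)) {A : ℝ}
    (hA : 0 < A) :
    (max ‖z - x‖ A) ^ (-a) ≤ ((1 + ‖x‖) / A + 1) ^ a * (1 + ‖z‖) ^ (-a) := by
  have hm : 0 < max ‖z - x‖ A := lt_max_of_lt_right hA
  have hK : 0 < (1 + ‖x‖) / A + 1 := by positivity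
  have h1 : (1 + ‖z‖) ≤ ((1 + ‖x‖) / A + 1) * max ‖z - x‖ A := by
    have h2 : ‖z‖ ≤ ‖z - x‖ + ‖x‖ := by simpa using norm_add_le (z - x) x
    have h3 : (1 + ‖x‖) / A * max ‖z - x‖ A ≥ 1 + ‖x‖ := by
      calc (1 + ‖x‖) / A * max ‖z - x‖ A ≥ (1 + ‖x‖) / A * A := by gcongr; exact le_max_right _ _
        _ = 1 + ‖x‖ := by field_simp
    nlinarith [le_max_left ‖z - x‖ A]
  rw [Real.rpow_neg hm.le, Real.rpow_neg (by positivity), ← div_eq_mul_inv,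
    le_div_iff₀ (by positivity), ← div_eq_inv_mul, div_le_iff₀ (by positivity),
    ← Real.mul_rpow hK.le hm.le]
  gcongr

lemma lintegral_mul_max_rpow_ne_top {c a : ℝ} (ha : 0 < a) (hca : c ≤ a)
    {u : EuclideanSpace ℝ (Fin n) → ℂ}
    (hu : Integrable (fun x => (((1 + ‖x‖) ^ (-c) : ℝ) : ℂ) * u x) volume)
      (x : EuclideanSpace ℝ (Fin n)) {A : ℝ}
    (hA : 0 < A) :
    ∫⁻ z, ‖u z‖ₑ * ENNReal.ofReal ((max ‖z - x‖ A) ^ (-a)) ≠ ∞ := by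
  refine ne_top_of_le_ne_top (ENNReal.mul_ne_top (a := ENNReal.ofReal (((1 + ‖x‖) / A + 1) ^ a))
    ENNReal.ofReal_ne_top (lintegral_weighted_ne_top hu)) ?_
  rw [← lintegral_const_mul' _ _ ENNReal.ofReal_ne_top]
  apply lintegral_mono
  intro z
  dsimp only
  rw [mul_left_comm, ← ENNReal.ofReal_mul (by positivity)]
  gcongr
  refine (max_rpow_le_one_add_norm_rpow ha x z hA).trans ?_
  gcongr
  linarith [norm_nonneg z]

lemma integrable_mul_dilate {c : ℝ} (hcn : c ≤ n + 1) {u : EuclideanSpace ℝ (Fin n) → ℂ}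
    (hu : Integrable (fun x => (((1 + ‖x‖) ^ (-c) : ℝ) : ℂ) * u x) volume)
      (φ : 𝓢(EuclideanSpace ℝ (Fin n), ℂ))
    {t : ℝ} (ht : 0 < t) (x : EuclideanSpace ℝ (Fin n)) :
    Integrable (fun z => u z * φ (t⁻¹ • (z - x))) volume := by
  obtain ⟨B, hB⟩ := φ.exists_enorm_dilate_le
  refine ⟨(locallyIntegrable_of_weighted hu).aestronglyMeasurable.mul
    (φ.continuous.comp (by fun_prop)).aestronglyMeasurable, ?_⟩
  have hfin := lintegral_mul_max_rpow_ne_top (a := (n : ℝ) + 1) (by positivity) hcn hu x ht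
  refine lt_of_le_of_lt ?_ (ENNReal.mul_lt_top (a := B * ENNReal.ofReal (t ^ (n + 1)))
    (ENNReal.mul_lt_top ENNReal.coe_lt_top ENNReal.ofReal_lt_top) hfin.lt_top)
  rw [← lintegral_const_mul' _ _ (ENNReal.mul_ne_top ENNReal.coe_ne_top ENNReal.ofReal_ne_top)]
  apply lintegral_mono
  intro z
  dsimp only
  rw [enorm_mul, mul_left_comm]
  gcongr
  exact (hB t ht x z).1

end Weighted

/-! ### Means at scale `t`: dyadic differences and the limit at small scales. -/

section Hajlasz

variable {n : ℕ}

/-- The mean of `u` at scale `t` around `x` with profile `χ`. -/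
noncomputable def scaleMean (χ : 𝓢(EuclideanSpace ℝ (Fin n), ℂ))
    (u : EuclideanSpace ℝ (Fin n) → ℂ) (t : ℝ) (x : EuclideanSpace ℝ (Fin n)) : ℂ :=
  (((t ^ n)⁻¹ : ℝ) : ℂ) * ∫ z, u z * χ (t⁻¹ • (z - x))

/-- The pairing of a fractional derivative with a dilated Schwartz function. -/
lemma HasFracDeriv.integral_mul_dilate {s : ℝ} {u g : EuclideanSpace ℝ (Fin n) → ℂ}
    (h : HasFracDeriv s u g)
    (θ : 𝓢(EuclideanSpace ℝ (Fin n), ℂ)) {t : ℝ} (ht : 0 < t) (x : EuclideanSpace ℝ (Fin n)) :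
    ∫ z, u z * fracDerivSchwartz s θ (t⁻¹ • (z - x)) =
      ((t ^ s : ℝ) : ℂ) * ∫ z, g z * θ (t⁻¹ • (z - x)) := by
  have h1 := (h.2 (θ.dilateAt (inv_pos.2 ht).ne' x)).2
  simp only [fracDerivSchwartz_dilateAt s θ (inv_pos.2 ht), SchwartzMap.dilateAt_apply] at h1
  rw [← h1, ← integral_const_mul]
  congr 1
  ext z
  rw [Real.inv_rpow ht.le, Complex.ofReal_inv]
  have : ((t ^ s : ℝ) : ℂ) ≠ 0 := by
    rw [Complex.ofReal_ne_zero]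
    positivity
  field_simp

/-- The choice of `χ` and `θ` makes a dyadic difference of means the pairing of `u` with a dilate of
`|∇|^s θ`; duality moves the derivative onto `u`, and scaling produces `t ^ s`. -/
lemma HasFracDeriv.scaleMean_sub {s : ℝ} (hs1 : s < 1) {u g : EuclideanSpace ℝ (Fin n) → ℂ}
    (h : HasFracDeriv s u g) {χ θ : 𝓢(EuclideanSpace ℝ (Fin n), ℂ)}
    (hχθ : ∀ w, fracDerivSchwartz s θ w = (2 : ℂ) ^ n * χ ((2 : ℝ) • w) - χ w)
    {t : ℝ} (ht : 0 < t) (x : EuclideanSpace ℝ (Fin n)) :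
    scaleMean χ u (t / 2) x - scaleMean χ u t x =
      ((t ^ s / t ^ n : ℝ) : ℂ) * ∫ z, g z * θ (t⁻¹ • (z - x)) := by
  have hc : (n : ℝ) + s ≤ n + 1 := by linarith
  have h1 := h.integral_mul_dilate θ ht x
  have h2 : ∀ z, (2 : ℝ) • (t⁻¹ • (z - x)) = (t / 2)⁻¹ • (z - x) := fun z => by
    rw [smul_smul, inv_div, div_eq_mul_inv]
  simp only [hχθ, h2] at h1
  have h3 : ∀ z, u z * ((2 : ℂ) ^ n * χ ((t / 2)⁻¹ • (z - x)) - χ (t⁻¹ • (z - x))) =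
      (2 : ℂ) ^ n * (u z * χ ((t / 2)⁻¹ • (z - x))) - u z * χ (t⁻¹ • (z - x)) := fun z => by ring
  simp only [h3] at h1
  rw [integral_sub ((integrable_mul_dilate hc h.1 χ (half_pos ht) x).const_mul _)
    (integrable_mul_dilate hc h.1 χ ht x), integral_const_mul] at h1
  rw [Complex.ofReal_div, div_mul_eq_mul_div, ← h1]
  unfold scaleMean
  have : (t : ℂ) ≠ 0 := Complex.ofReal_ne_zero.2 ht.ne'
  push_cast
  rw [div_pow]
  field_simp

lemma norm_le_of_enorm_le_mul {a : ℂ} {C : ℝ≥0} {b : ℝ} {M : ℝ≥0∞} (hM : M ≠ ∞) (hb : 0 ≤ b)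
    (h : ‖a‖ₑ ≤ C * ENNReal.ofReal b * M) : ‖a‖ ≤ C * b * M.toReal := by
  have h2 := ENNReal.toReal_mono (ENNReal.mul_ne_top
    (ENNReal.mul_ne_top ENNReal.coe_ne_top ENNReal.ofReal_ne_top) hM) h
  rwa [ENNReal.toReal_mul, ENNReal.toReal_mul, ENNReal.toReal_ofReal hb, toReal_enorm] at h2

/-- `x` is a Lebesgue point of `u`. -/
def IsLebesguePoint (u : EuclideanSpace ℝ (Fin n) → ℂ) (x : EuclideanSpace ℝ (Fin n)) : Prop :=
  ∀ ε : ℝ≥0∞, 0 < ε → ∃ δ : ℝ, 0 < δ ∧ ∀ r : ℝ, 0 < r → r ≤ δ →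
    ∫⁻ z in Metric.closedBall x r, ‖u z - u x‖ₑ ≤ ε * volume (Metric.closedBall x r)

lemma ae_isLebesguePoint {u : EuclideanSpace ℝ (Fin n) → ℂ} (hu : LocallyIntegrable u volume) :
    ∀ᵐ x, IsLebesguePoint u x := by
  filter_upwards [(IsUnifLocDoublingMeasure.vitaliFamily
      (volume : Measure (EuclideanSpace ℝ (Fin n))) 1
    ).ae_tendsto_lintegral_enorm_sub_div hu] with x hx ε hε
  have h1 := hx.comp (IsUnifLocDoublingMeasure.tendsto_closedBall_filterAt volume
    (fun _ : ℝ => x) (fun r : ℝ => r) (l := nhdsWithin (0 : ℝ) (Set.Ioi 0)) (K := 1)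
    Filter.tendsto_id (by
      filter_upwards [self_mem_nhdsWithin] with r hr
      exact Metric.mem_closedBall_self (by simpa using (Set.mem_Ioi.1 hr).le)))
  have h2 := h1.eventually (gt_mem_nhds hε)
  obtain ⟨δ, hδ, hδ2⟩ := mem_nhdsGT_iff_exists_Ioc_subset.1 h2
  refine ⟨δ, hδ, fun r hr hrδ => ?_⟩
  have h3 := hδ2 ⟨hr, hrδ⟩
  simp only [Set.mem_ofPred_eq, Function.comp_def] at h3
  exact (ENNReal.div_le_iff (Metric.measure_closedBall_pos volume x hr).ne'
    measure_closedBall_lt_top.ne).1 h3.le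

/-- After truncation to radius `δ`, larger balls carry no more mass than the ball of radius `δ`, so
only radii up to `δ` matter. -/
lemma maximalFn_indicator_closedBall_le {f : EuclideanSpace ℝ (Fin n) → ℝ≥0∞}
    {x : EuclideanSpace ℝ (Fin n)} {δ : ℝ} (hδ : 0 < δ) {ε : ℝ≥0∞}
    (h : ∀ r : ℝ, 0 < r → r ≤ δ →
      ∫⁻ z in Metric.closedBall x r, f z ≤ ε * volume (Metric.closedBall x r)) :
    maximalFn volume (Set.indicator (Metric.closedBall x δ) f) x ≤ ε := by
  apply iSup_le
  intro k
  rw [ENNReal.div_le_iff (measure_closedBall_two_zpow_ne_zero x k)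
    (measure_closedBall_ne_top' x _), setLIntegral_indicator Metric.isClosed_closedBall.measurableSet]
  rcases le_total ((2 : ℝ) ^ k) δ with hk | hk
  · exact (lintegral_mono_set Set.inter_subset_right).trans (h _ (by positivity) hk)
  · calc _ ≤ ∫⁻ z in Metric.closedBall x δ, f z := lintegral_mono_set Set.inter_subset_left
      _ ≤ ε * volume (Metric.closedBall x δ) := h δ hδ le_rfl
      _ ≤ _ := by gcongr

lemma integral_dilate (χ : 𝓢(EuclideanSpace ℝ (Fin n), ℂ)) {t : ℝ} (ht : 0 < t)
    (x : EuclideanSpace ℝ (Fin n)) :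
    ∫ z, χ (t⁻¹ • (z - x)) = ((t ^ n : ℝ) : ℂ) * ∫ z, χ z := by
  rw [integral_sub_right_eq_self (fun z => χ (t⁻¹ • z)) x,
    Measure.integral_comp_smul volume (fun z => χ z) t⁻¹, finrank_euclideanSpace_fin,
    inv_pow, inv_inv, abs_of_pos (by positivity), Complex.real_smul]

/-- The error is split at a radius `δ` where the means of `|u - u x|` are small. The near part is
controlled by the maximal function of the truncation, the far part is `O(t)`. Here `n < c` makes
constants weighted integrable, and `c ≤ n + 1` matches the kernel decay. -/
lemma tendsto_scaleMean {c : ℝ} (hc0 : n < c) (hcn : c ≤ n + 1) {u : EuclideanSpace ℝ (Fin n) → ℂ}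
    (hu : Integrable (fun x => (((1 + ‖x‖) ^ (-c) : ℝ) : ℂ) * u x) volume)
      {χ : 𝓢(EuclideanSpace ℝ (Fin n), ℂ)}
    (hχ : ∫ z, χ z = 1) {x : EuclideanSpace ℝ (Fin n)} (hx : IsLebesguePoint u x) :
    Filter.Tendsto (fun t => scaleMean χ u t x) (nhdsWithin 0 (Set.Ioi 0)) (nhds (u x)) := by
  obtain ⟨B, hB⟩ := χ.exists_enorm_dilate_le
  obtain ⟨C, hC⟩ := exists_lintegral_mul_max_rpow_le n one_pos
  set f : EuclideanSpace ℝ (Fin n) → ℝ≥0∞ := fun z => ‖u z - u x‖ₑ with hf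
  have hum : AEStronglyMeasurable u volume :=
      (locallyIntegrable_of_weighted hu).aestronglyMeasurable
  have hfm : AEMeasurable f volume := (hum.sub aestronglyMeasurable_const).enorm
  have hconst : ∀ v : ℂ, Integrable
      (fun y : EuclideanSpace ℝ (Fin n) => (((1 + ‖y‖) ^ (-c) : ℝ) : ℂ) * v) volume := by
    intro v
    apply Integrable.mul_const
    exact (integrable_one_add_norm (by rwa [finrank_euclideanSpace_fin])).ofReal
  have hu' : Integrable (fun y => (((1 + ‖y‖) ^ (-c) : ℝ) : ℂ) * (u y - u x)) volume := by
    simpa only [mul_sub] using! hu.sub (hconst (u x))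
  have hbound : ∀ t : ℝ, 0 < t → ‖scaleMean χ u t x - u x‖ₑ ≤ B * (ENNReal.ofReal t *
      ∫⁻ z, f z * ENNReal.ofReal ((max ‖z - x‖ t) ^ (-((n : ℝ) + 1)))) := by
    intro t ht
    -- Since `χ` has integral one, the constant `u x` can be moved under the integral.
    have h1 : scaleMean χ u t x - u x = (((t ^ n)⁻¹ : ℝ) : ℂ) *
        ∫ z, (u z - u x) * χ (t⁻¹ • (z - x)) := by
      simp only [sub_mul]
      rw [integral_sub (integrable_mul_dilate hcn hu χ ht x)
        (integrable_mul_dilate (u := fun _ => u x) hcn (hconst _) χ ht x), integral_const_mul,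
        integral_dilate χ ht, hχ]
      unfold scaleMean
      have : (t : ℂ) ≠ 0 := Complex.ofReal_ne_zero.2 ht.ne'
      push_cast
      field_simp
    rw [h1, enorm_mul, ← ofReal_norm, Complex.norm_real, Real.norm_of_nonneg (by positivity)]
    calc _ ≤ ENNReal.ofReal ((t ^ n)⁻¹) * ∫⁻ z, (B * ENNReal.ofReal (t ^ (n + 1))) *
          (f z * ENNReal.ofReal ((max ‖z - x‖ t) ^ (-((n : ℝ) + 1)))) := by
          gcongr
          refine (enorm_integral_le_lintegral_enorm _).trans (lintegral_mono fun z => ?_)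
          rw [enorm_mul, mul_left_comm]
          gcongr
          exact (hB t ht x z).1
      _ = _ := by
          rw [lintegral_const_mul' _ _
              (ENNReal.mul_ne_top ENNReal.coe_ne_top ENNReal.ofReal_ne_top),
            show t = (t ^ n)⁻¹ * t ^ (n + 1) by rw [pow_succ]; field_simp,
            ENNReal.ofReal_mul (by positivity)]
          rw [show (t ^ n)⁻¹ * t ^ (n + 1) = t by rw [pow_succ]; field_simp]
          ring
  rw [tendsto_iff_edist_tendsto_0]
  simp only [edist_eq_enorm_sub]
  rw [ENNReal.tendsto_nhds_zero]
  intro ε hε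
  -- choose the radius on which the averages are small
  obtain ⟨ε', hε', hεε'⟩ : ∃ ε' : ℝ≥0∞, 0 < ε' ∧ B * (C * ε') ≤ ε / 2 := by
    refine ⟨min 1 ((ε / 2) / ((B * C : ℝ≥0) + 1)), ?_, ?_⟩
    · refine lt_min one_pos (ENNReal.div_pos (ENNReal.half_pos hε.ne').ne' (by finiteness))
    · calc (B : ℝ≥0∞) * (C * min 1 ((ε / 2) / ((B * C : ℝ≥0) + 1)))
          ≤ ((B * C : ℝ≥0) + 1) * ((ε / 2) / ((B * C : ℝ≥0) + 1)) := by
            rw [← mul_assoc]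
            gcongr
            · push_cast; exact le_self_add
            · exact min_le_right _ _
        _ ≤ _ := ENNReal.mul_div_le
  obtain ⟨δ, hδ, hδ2⟩ := hx ε' hε'
  -- A finite majorant of the far part independent of `t`: outside the `δ`-ball the kernel at scale
  -- `t` is at most the one truncated at `δ`.
  set K := ∫⁻ z, f z * ENNReal.ofReal ((max ‖z - x‖ δ) ^ (-((n : ℝ) + 1))) with hK
  have hKtop : K ≠ ∞ := lintegral_mul_max_rpow_ne_top (by positivity) hcn hu' x hδ
  have hev : ∀ᶠ t : ℝ in nhdsWithin 0 (Set.Ioi 0), B * (ENNReal.ofReal t * K) ≤ ε / 2 := by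
    have h1 : Filter.Tendsto (fun t : ℝ => B * (ENNReal.ofReal t * K)) (nhdsWithin 0 (Set.Ioi 0))
        (nhds (B * (ENNReal.ofReal 0 * K))) := by
      apply ENNReal.Tendsto.const_mul _ (Or.inr ENNReal.coe_ne_top)
      apply ENNReal.Tendsto.mul_const _ (Or.inr hKtop)
      exact (ENNReal.continuous_ofReal.tendsto 0).mono_left nhdsWithin_le_nhds
    simp only [ENNReal.ofReal_zero, zero_mul, mul_zero] at h1
    exact (ENNReal.tendsto_nhds_zero.1 h1) _ (ENNReal.half_pos hε.ne')
  filter_upwards [hev, self_mem_nhdsWithin] with t ht1 ht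
  have ht : (0 : ℝ) < t := ht
  refine (hbound t ht).trans ?_
  calc B * (ENNReal.ofReal t *
        ∫⁻ z, f z * ENNReal.ofReal ((max ‖z - x‖ t) ^ (-((n : ℝ) + 1))))
      ≤ B * (ENNReal.ofReal t * ((∫⁻ z, Set.indicator (Metric.closedBall x δ) f z *
          ENNReal.ofReal ((max ‖z - x‖ t) ^ (-((n : ℝ) + 1)))) + K)) := by
        gcongr
        rw [hK, ← lintegral_add_left']
        · apply lintegral_mono
          intro z
          by_cases hz : z ∈ Metric.closedBall x δ
          · simp only [Set.indicator, hz, if_true]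
            exact le_self_add
          · simp only [Set.indicator, hz, if_false, zero_mul, zero_add]
            have hz' : δ ≤ ‖z - x‖ := by
              rw [Metric.mem_closedBall, dist_eq_norm, not_le] at hz
              exact hz.le
            rw [max_eq_left hz']
            refine mul_le_mul_right (ENNReal.ofReal_le_ofReal ?_) _
            apply Real.rpow_le_rpow_of_nonpos (hδ.trans_le hz') (le_max_left _ _)
            linarith [(n.cast_nonneg : (0 : ℝ) ≤ n)]
        · exact (hfm.indicator Metric.isClosed_closedBall.measurableSet).mul
            (by fun_prop)
    _ ≤ B * (ENNReal.ofReal t * ((C * ENNReal.ofReal (t ^ (-1 : ℝ)) * ε') + K)) := by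
        gcongr
        refine (hC _ (hfm.indicator Metric.isClosed_closedBall.measurableSet) x t ht).trans ?_
        gcongr
        exact maximalFn_indicator_closedBall_le hδ hδ2
    _ = B * (C * ε') + B * (ENNReal.ofReal t * K) := by
        have : ENNReal.ofReal t * ENNReal.ofReal (t ^ (-1 : ℝ)) = 1 := by
          rw [← ENNReal.ofReal_mul ht.le, Real.rpow_neg_one, mul_inv_cancel₀ ht.ne',
            ENNReal.ofReal_one]
        calc _ = B * (C * ε') * (ENNReal.ofReal t * ENNReal.ofReal (t ^ (-1 : ℝ))) +
              B * (ENNReal.ofReal t * K) := by ring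
          _ = _ := by rw [this, mul_one]
    _ ≤ ε / 2 + ε / 2 := add_le_add hεε' ht1
    _ = ε := ENNReal.add_halves ε

end Hajlasz

/-! ### The Hajłasz inequality. -/

section HajlaszInequality

variable {n : ℕ}

/-- The kernel increments decay with order `n + 1`, whereas integrability of `u` uses only order `n
+ s`; the surplus is `t ^ (s - 1) → 0`. Thus telescoping to infinite scale leaves no remainder. -/
lemma tendsto_scaleMean_sub_atTop {s : ℝ} (hs0 : 0 < s) (hs1 : s < 1)
    {u : EuclideanSpace ℝ (Fin n) → ℂ}
    (hu : Integrable (fun x => (((1 + ‖x‖) ^ (-((n : ℝ) + s)) : ℝ) : ℂ) * u x) volume)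
    (χ : 𝓢(EuclideanSpace ℝ (Fin n), ℂ)) (x y : EuclideanSpace ℝ (Fin n)) :
    Filter.Tendsto (fun t => scaleMean χ u t x - scaleMean χ u t y) Filter.atTop (nhds 0) := by
  obtain ⟨B, hB⟩ := χ.exists_enorm_dilate_le
  have hcn : (n : ℝ) + s ≤ n + 1 := by linarith
  set K := ∫⁻ z, ‖u z‖ₑ * ENNReal.ofReal ((max ‖z - x‖ 1) ^ (-((n : ℝ) + s))) with hK
  have hKtop : K ≠ ∞ := lintegral_mul_max_rpow_ne_top (by positivity) le_rfl hu x one_pos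
  have hbound : ∀ t : ℝ, 1 ≤ t → ‖x - y‖ ≤ t → ‖scaleMean χ u t x - scaleMean χ u t y‖ₑ ≤
      B * ENNReal.ofReal ‖x - y‖ * (ENNReal.ofReal (t ^ (s - 1)) * K) := by
    intro t ht1 hxy
    have ht : 0 < t := by linarith
    have h1 : scaleMean χ u t x - scaleMean χ u t y = (((t ^ n)⁻¹ : ℝ) : ℂ) *
        ∫ z, u z * (χ (t⁻¹ • (z - x)) - χ (t⁻¹ • (z - y))) := by
      simp only [mul_sub]
      rw [integral_sub (integrable_mul_dilate hcn hu χ ht x)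
        (integrable_mul_dilate hcn hu χ ht y)]
      unfold scaleMean
      ring
    have h2 : ∀ z, (max ‖z - x‖ t) ^ (-((n : ℝ) + 1)) ≤
        t ^ (s - 1) * (max ‖z - x‖ 1) ^ (-((n : ℝ) + s)) := by
      intro z
      have hm : 0 < max ‖z - x‖ t := lt_max_of_lt_right ht
      rw [show -((n : ℝ) + 1) = (s - 1) + (-((n : ℝ) + s)) by ring, Real.rpow_add hm]
      have h3 : (0 : ℝ) ≤ n := n.cast_nonneg
      gcongr ?_ * ?_
      · exact Real.rpow_le_rpow_of_nonpos ht (le_max_right _ _) (by linarith)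
      · exact Real.rpow_le_rpow_of_nonpos (lt_max_of_lt_right one_pos)
          (max_le_max le_rfl ht1) (by linarith)
    rw [h1, enorm_mul, ← ofReal_norm, Complex.norm_real, Real.norm_of_nonneg (by positivity)]
    calc _ ≤ ENNReal.ofReal ((t ^ n)⁻¹) * ∫⁻ z, (B * ENNReal.ofReal (‖x - y‖ * t ^ n) *
            ENNReal.ofReal (t ^ (s - 1))) *
          (‖u z‖ₑ * ENNReal.ofReal ((max ‖z - x‖ 1) ^ (-((n : ℝ) + s)))) := by
          gcongr
          refine (enorm_integral_le_lintegral_enorm _).trans (lintegral_mono fun z => ?_)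
          rw [enorm_mul, mul_left_comm]
          refine mul_le_mul_right (((hB t ht x z).2 y hxy).trans ?_) _
          rw [mul_assoc _ (ENNReal.ofReal (t ^ (s - 1))), ← ENNReal.ofReal_mul (by positivity)]
          gcongr
          exact h2 z
      _ = _ := by
          rw [lintegral_const_mul' _ _ (by finiteness), ENNReal.ofReal_mul (by positivity)]
          have : ENNReal.ofReal ((t ^ n)⁻¹) * ENNReal.ofReal (t ^ n) = 1 := by
            rw [← ENNReal.ofReal_mul (by positivity), inv_mul_cancel₀ (by positivity),
              ENNReal.ofReal_one]
          calc _ = (ENNReal.ofReal ((t ^ n)⁻¹) * ENNReal.ofReal (t ^ n)) *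
                (B * ENNReal.ofReal ‖x - y‖ * (ENNReal.ofReal (t ^ (s - 1)) * K)) := by ring
            _ = _ := by rw [this, one_mul]
  rw [tendsto_iff_edist_tendsto_0]
  simp only [edist_zero_right]
  have hlim : Filter.Tendsto (fun t : ℝ => B * ENNReal.ofReal ‖x - y‖ *
      (ENNReal.ofReal (t ^ (s - 1)) * K)) Filter.atTop
      (nhds (B * ENNReal.ofReal ‖x - y‖ * (ENNReal.ofReal 0 * K))) := by
    apply ENNReal.Tendsto.const_mul _ (Or.inr (by finiteness))
    apply ENNReal.Tendsto.mul_const _ (Or.inr hKtop)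
    apply ENNReal.tendsto_ofReal
    have := tendsto_rpow_neg_atTop (y := 1 - s) (by linarith)
    simpa using this
  simp only [ENNReal.ofReal_zero, zero_mul, mul_zero] at hlim
  refine tendsto_of_tendsto_of_tendsto_of_le_of_le' tendsto_const_nhds hlim
    (Filter.Eventually.of_forall fun _ => zero_le) ?_
  filter_upwards [Filter.eventually_ge_atTop (1 : ℝ), Filter.eventually_ge_atTop ‖x - y‖]
    with t h1 h2 using hbound t h1 h2

/-- A function with fractional derivative `g` of order `s ∈ (0,1)` satisfies a Hajłasz type
inequality with the maximal function of `g`. -/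
theorem exists_norm_sub_le_maximalFn (n : ℕ) {s : ℝ} (hs0 : 0 < s) (hs1 : s < 1) :
    ∃ C : ℝ≥0, ∀ u g : EuclideanSpace ℝ (Fin n) → ℂ, HasFracDeriv s u g →
        AEStronglyMeasurable g volume →
      ∀ x y : EuclideanSpace ℝ (Fin n), IsLebesguePoint u x → IsLebesguePoint u y →
        maximalFn volume (fun z => ‖g z‖ₑ) x ≠ ∞ → maximalFn volume (fun z => ‖g z‖ₑ) y ≠ ∞ →
        ‖u x - u y‖ₑ ≤ C * ENNReal.ofReal (‖x - y‖ ^ s) *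
          (maximalFn volume (fun z => ‖g z‖ₑ) x + maximalFn volume (fun z => ‖g z‖ₑ) y) := by
  obtain ⟨χ, θ, hχ, hχθ⟩ := exists_littlewoodPaley_kernel n s
  obtain ⟨C, hC⟩ := θ.exists_lintegral_dilate_le
  have hq1 : (2 : ℝ) ^ (-s) < 1 := Real.rpow_lt_one_of_one_lt_of_neg one_lt_two (by linarith)
  have hq2 : (2 : ℝ) ^ (s - 1) < 1 := Real.rpow_lt_one_of_one_lt_of_neg one_lt_two (by linarith)
  have hq1' : 0 < 1 - (2 : ℝ) ^ (-s) := by linarith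
  have hq2' : 0 < 1 - (2 : ℝ) ^ (s - 1) := by linarith
  -- The sums of two geometric series: scales below `‖x - y‖` have ratio `2 ^ (-s)`, scales above it
  -- have ratio `2 ^ (s - 1)`.
  set D : ℝ := C / (1 - (2 : ℝ) ^ (-s)) + C / (1 - (2 : ℝ) ^ (s - 1)) with hD
  have hD0 : 0 ≤ D := by positivity
  refine ⟨D.toNNReal, fun u g h hg x y hx hy hMx hMy => ?_⟩
  have hgm : AEMeasurable (fun z => ‖g z‖ₑ) volume := hg.enorm
  set M := maximalFn volume (fun z => ‖g z‖ₑ) with hM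
  rcases eq_or_ne x y with rfl | hxy
  · simp
  set r := ‖x - y‖ with hr
  have hr0 : 0 < r := norm_pos_iff.2 (sub_ne_zero.2 hxy)
  have hloc : ∀ (w : EuclideanSpace ℝ (Fin n)), M w ≠ ∞ → ∀ t : ℝ, 0 < t →
      ‖scaleMean χ u (t / 2) w - scaleMean χ u t w‖ ≤ C * t ^ s * (M w).toReal := by
    intro w hw t ht
    apply norm_le_of_enorm_le_mul hw (by positivity)
    rw [h.scaleMean_sub hs1 hχθ ht w, enorm_mul, ← ofReal_norm, Complex.norm_real,
      Real.norm_of_nonneg (by positivity)]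
    calc _ ≤ ENNReal.ofReal (t ^ s / t ^ n) * (C * ENNReal.ofReal (t ^ n) * M w) := by
          gcongr
          refine (enorm_integral_le_lintegral_enorm _).trans ?_
          simp only [enorm_mul]
          exact (hC _ hgm t ht w).1
      _ = C * (ENNReal.ofReal (t ^ s / t ^ n) * ENNReal.ofReal (t ^ n)) * M w := by ring
      _ = _ := by
          rw [← ENNReal.ofReal_mul (by positivity), div_mul_cancel₀ _ (by positivity)]
  -- Above scale `r` the means at `x` and `y` are compared together: smoothness of `θ` gains `r /
  -- t`, turning the growing `t ^ s` into the decaying `r * t ^ (s - 1)`.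
  have hfar : ∀ t : ℝ, r ≤ t →
      ‖(scaleMean χ u (t / 2) x - scaleMean χ u (t / 2) y) -
        (scaleMean χ u t x - scaleMean χ u t y)‖ ≤ C * (r * t ^ (s - 1)) * (M x).toReal := by
    intro t hrt
    have ht : 0 < t := hr0.trans_le hrt
    apply norm_le_of_enorm_le_mul hMx (by positivity)
    rw [sub_sub_sub_comm, h.scaleMean_sub hs1 hχθ ht x, h.scaleMean_sub hs1 hχθ ht y, ← mul_sub]
    have hint : ∀ w, Integrable (fun z => g z * θ (t⁻¹ • (z - w))) volume := fun w =>
      (h.2 (θ.dilateAt (inv_pos.2 ht).ne' w)).1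
    rw [← integral_sub (hint x) (hint y), enorm_mul, ← ofReal_norm, Complex.norm_real,
      Real.norm_of_nonneg (by positivity)]
    simp only [← mul_sub]
    calc _ ≤ ENNReal.ofReal (t ^ s / t ^ n) * (C * ENNReal.ofReal (r * t ^ n / t) * M x) := by
          gcongr
          refine (enorm_integral_le_lintegral_enorm _).trans ?_
          simp only [enorm_mul]
          exact (hC _ hgm t ht x).2 y hrt
      _ = C * (ENNReal.ofReal (t ^ s / t ^ n) * ENNReal.ofReal (r * t ^ n / t)) * M x := by ring
      _ = _ := by
          rw [← ENNReal.ofReal_mul (by positivity), Real.rpow_sub_one ht.ne']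
          congr 3
          field_simp
  have hnear : ∀ w : EuclideanSpace ℝ (Fin n), IsLebesguePoint u w → M w ≠ ∞ →
      ‖scaleMean χ u r w - u w‖ ≤ C * r ^ s * (M w).toReal / (1 - 2 ^ (-s)) := by
    intro w hw hMw
    have hlim : Filter.Tendsto (fun j : ℕ => scaleMean χ u (r / 2 ^ j) w) Filter.atTop
        (nhds (u w)) := by
      refine (tendsto_scaleMean (by linarith) (by linarith) h.1 hχ hw).comp ?_
      rw [tendsto_nhdsWithin_iff]
      refine ⟨?_, Filter.Eventually.of_forall fun j => Set.mem_Ioi.2 (by positivity)⟩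
      have := (tendsto_pow_atTop_nhds_zero_of_lt_one (r := (1 / 2 : ℝ)) (by norm_num)
        (by norm_num)).const_mul r
      simpa [div_eq_mul_inv] using this
    have := dist_le_of_le_geometric_of_tendsto₀ ((2 : ℝ) ^ (-s)) (C * r ^ s * (M w).toReal) hq1
      (fun j => ?_) hlim
    · simpa [dist_eq_norm] using this
    · rw [dist_comm, dist_eq_norm, pow_succ, ← div_div]
      refine (hloc w hMw (r / 2 ^ j) (by positivity)).trans_eq ?_
      rw [Real.div_rpow hr0.le (by positivity), ← Real.rpow_natCast, ← Real.rpow_natCast,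
        ← Real.rpow_mul two_pos.le, ← Real.rpow_mul two_pos.le, div_eq_mul_inv,
        ← Real.rpow_neg two_pos.le]
      rw [show -((j : ℝ) * s) = -s * j by ring]
      ring
  have hfar' : ‖scaleMean χ u r x - scaleMean χ u r y‖ ≤
      C * r ^ s * (M x).toReal / (1 - 2 ^ (s - 1)) := by
    have hlim : Filter.Tendsto (fun j : ℕ => scaleMean χ u (r * 2 ^ j) x -
        scaleMean χ u (r * 2 ^ j) y) Filter.atTop (nhds 0) := by
      refine (tendsto_scaleMean_sub_atTop hs0 hs1 h.1 χ x y).comp ?_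
      exact (tendsto_pow_atTop_atTop_of_one_lt one_lt_two).const_mul_atTop hr0
    have := dist_le_of_le_geometric_of_tendsto₀ ((2 : ℝ) ^ (s - 1)) (C * r ^ s * (M x).toReal) hq2
      (fun j => ?_) hlim
    · simpa [dist_eq_norm] using this
    -- The bound is stated at the larger of the two scales, hence `j + 1`; the extra factor `2 ^ (s
    -- - 1) ≤ 1` is dropped.
    · have h1 := hfar (r * 2 ^ (j + 1)) (le_mul_of_one_le_right hr0.le (one_le_pow₀ one_le_two))
      rw [show r * 2 ^ (j + 1) / 2 = r * 2 ^ j by rw [pow_succ]; ring] at h1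
      rw [dist_eq_norm]
      refine h1.trans ?_
      rw [Real.mul_rpow hr0.le (by positivity)]
      have h2 : r * (r ^ (s - 1) * ((2 : ℝ) ^ (j + 1)) ^ (s - 1)) ≤ r ^ s * (2 ^ (s - 1)) ^ j := by
        rw [← mul_assoc, mul_comm r, ← Real.rpow_add_one hr0.ne', sub_add_cancel]
        gcongr
        rw [← Real.rpow_natCast, ← Real.rpow_natCast, ← Real.rpow_mul two_pos.le,
          ← Real.rpow_mul two_pos.le]
        apply Real.rpow_le_rpow_of_exponent_le one_le_two
        push_cast
        nlinarith
      calc _ ≤ C * (r ^ s * (2 ^ (s - 1)) ^ j) * (M x).toReal := by gcongr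
        _ = _ := by ring
  have hreal : ‖u x - u y‖ ≤ D * r ^ s * ((M x).toReal + (M y).toReal) := by
    have h1 := hnear x hx hMx
    have h2 := hnear y hy hMy
    have h3 : u x - u y = -(scaleMean χ u r x - u x) + (scaleMean χ u r y - u y) +
      (scaleMean χ u r x - scaleMean χ u r y) := by ring
    rw [h3]
    refine (norm_add₃_le).trans ?_
    rw [norm_neg]
    -- The large scales need only `M x`; this term is added to make the final bound symmetric.
    have h4 : 0 ≤ C * r ^ s * (M y).toReal / (1 - 2 ^ (s - 1)) := by positivity
    calc _ ≤ C * r ^ s * (M x).toReal / (1 - 2 ^ (-s)) + C * r ^ s * (M y).toReal / (1 - 2 ^ (-s)) +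
          (C * r ^ s * (M x).toReal / (1 - 2 ^ (s - 1)) +
            C * r ^ s * (M y).toReal / (1 - 2 ^ (s - 1))) := by linarith
      _ = _ := by rw [hD]; ring
  rw [← ofReal_norm, ← ENNReal.ofReal, ← ENNReal.ofReal_mul hD0, ← ENNReal.ofReal_toReal hMx,
    ← ENNReal.ofReal_toReal hMy, ← ENNReal.ofReal_add (by positivity) (by positivity),
    ← ENNReal.ofReal_mul (by positivity)]
  exact ENNReal.ofReal_le_ofReal hreal

end HajlaszInequality

/-! ### The symbol of the singular integral is a nonzero multiple of `‖ξ‖ ^ σ`. -/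

section FractionalKernel

variable {n : ℕ}

lemma maximalFn_one_le (x : EuclideanSpace ℝ (Fin n)) : maximalFn volume (fun _ => 1) x ≤ 1 := by
  apply iSup_le
  intro k
  rw [ENNReal.div_le_iff (measure_closedBall_two_zpow_ne_zero x k)
    (measure_closedBall_ne_top' x _), setLIntegral_const]

lemma exists_lintegral_max_rpow_le (n : ℕ) {c : ℝ} (hc : 0 < c) :
    ∃ C : ℝ≥0, ∀ A : ℝ, 0 < A →
      ∫⁻ y : EuclideanSpace ℝ (Fin n), ENNReal.ofReal ((max ‖y‖ A) ^ (-((n : ℝ) + c))) ≤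
        C * ENNReal.ofReal (A ^ (-c)) := by
  obtain ⟨C, hC⟩ := exists_lintegral_mul_max_rpow_le n hc
  refine ⟨C, fun A hA => ?_⟩
  have := hC (fun _ => 1) aemeasurable_const 0 A hA
  simp only [one_mul, sub_zero] at this
  refine this.trans (mul_le_of_le_one_right' (maximalFn_one_le 0))

lemma exists_setLIntegral_norm_rpow_le (n : ℕ) {β : ℝ} (hβ : 0 < β) (hβn : β < n) :
    ∃ C : ℝ≥0, ∀ A : ℝ, 0 < A →
      ∫⁻ y in Metric.closedBall (0 : EuclideanSpace ℝ (Fin n)) A, ENNReal.ofReal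
          (‖y‖ ^ (-((n : ℝ) - β))) ≤
        C * ENNReal.ofReal (A ^ β) := by
  obtain ⟨C, hC⟩ := exists_setLIntegral_mul_norm_rpow_le n hβ hβn
  refine ⟨C, fun A hA => ?_⟩
  have := hC (fun _ => 1) aemeasurable_const 0 A hA
  simp only [one_mul, sub_zero] at this
  refine this.trans (mul_le_of_le_one_right' (maximalFn_one_le 0))

lemma norm_mul_norm_rpow (y : EuclideanSpace ℝ (Fin n)) {σ : ℝ} (hσ : (1 : ℝ) - σ < n) :
    ‖y‖ * ‖y‖ ^ (-((n : ℝ) + σ)) = ‖y‖ ^ (-((n : ℝ) - (1 - σ))) := by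
  -- At `y = 0` both sides vanish by the convention for powers of `0`, which requires the right-hand
  -- exponent to be nonzero.
  rcases (norm_nonneg y).eq_or_lt with h | h
  · rw [← h, zero_mul, Real.zero_rpow (by linarith)]
  · rw [show -((n : ℝ) - (1 - σ)) = -((n : ℝ) + σ) + 1 by ring, Real.rpow_add_one h.ne', mul_comm]

/-- A function with `‖F y‖ ≤ a ‖y‖` and `‖F y‖ ≤ b` is integrable against the kernel
`|y|^{-n-σ}`. -/
lemma exists_lintegral_mul_kernel_le (hn : 1 ≤ n) {σ : ℝ} (hσ0 : 0 < σ) (hσ1 : σ < 1) :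
    ∃ C : ℝ≥0, ∀ (F : EuclideanSpace ℝ (Fin n) → ℝ≥0∞) (a b : ℝ) (A : ℝ), 0 ≤ a → 0 ≤ b → 0 < A →
      (∀ y, ‖y‖ ≤ A → F y ≤ ENNReal.ofReal (a * ‖y‖)) → (∀ y, A < ‖y‖ → F y ≤ ENNReal.ofReal b) →
      ∫⁻ y, F y * ENNReal.ofReal (‖y‖ ^ (-((n : ℝ) + σ))) ≤
        C * ENNReal.ofReal (a * A ^ (1 - σ) + b * A ^ (-σ)) := by
  have hn' : (1 : ℝ) ≤ n := by exact_mod_cast hn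
  obtain ⟨C1, hC1⟩ := exists_lintegral_max_rpow_le n hσ0
  obtain ⟨C2, hC2⟩ := exists_setLIntegral_norm_rpow_le n (β := 1 - σ) (by linarith) (by linarith)
  refine ⟨C1 + C2, fun F a b A ha hb hA h1 h2 => ?_⟩
  rw [← lintegral_add_compl _
      (Metric.isClosed_closedBall (x := (0 : EuclideanSpace ℝ (Fin n))) (ε := A)).measurableSet]
  have hin : ∫⁻ y in Metric.closedBall (0 : EuclideanSpace ℝ (Fin n)) A, F y * ENNReal.ofReal
      (‖y‖ ^ (-((n : ℝ) + σ))) ≤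
      C2 * ENNReal.ofReal (a * A ^ (1 - σ)) := by
    calc _ ≤ ∫⁻ y in Metric.closedBall (0 : EuclideanSpace ℝ (Fin n)) A,
          ENNReal.ofReal a * ENNReal.ofReal (‖y‖ ^ (-((n : ℝ) - (1 - σ)))) := by
          apply setLIntegral_mono' Metric.isClosed_closedBall.measurableSet
          intro y hy
          rw [mem_closedBall_zero_iff] at hy
          calc _ ≤ _ := mul_le_mul_left (h1 y hy) _
            _ = _ := by
              rw [← ENNReal.ofReal_mul (by positivity), ← ENNReal.ofReal_mul ha, mul_assoc,
                norm_mul_norm_rpow y (by linarith)]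
      _ ≤ ENNReal.ofReal a * (C2 * ENNReal.ofReal (A ^ (1 - σ))) := by
          rw [lintegral_const_mul' _ _ ENNReal.ofReal_ne_top]
          gcongr
          exact hC2 A hA
      _ = _ := by rw [ENNReal.ofReal_mul ha]; ring
  have hout : ∫⁻ y in (Metric.closedBall (0 : EuclideanSpace ℝ (Fin n)) A)ᶜ,
      F y * ENNReal.ofReal (‖y‖ ^ (-((n : ℝ) + σ))) ≤ C1 * ENNReal.ofReal (b * A ^ (-σ)) := by
    calc _ ≤ ∫⁻ y in (Metric.closedBall (0 : EuclideanSpace ℝ (Fin n)) A)ᶜ,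
          ENNReal.ofReal b * ENNReal.ofReal ((max ‖y‖ A) ^ (-((n : ℝ) + σ))) := by
          apply setLIntegral_mono' Metric.isClosed_closedBall.measurableSet.compl
          intro y hy
          rw [Set.mem_compl_iff, mem_closedBall_zero_iff, not_le] at hy
          rw [max_eq_left hy.le]
          gcongr
          exact h2 y hy
      _ ≤ ∫⁻ y : EuclideanSpace ℝ (Fin n), ENNReal.ofReal b * ENNReal.ofReal
          ((max ‖y‖ A) ^ (-((n : ℝ) + σ))) :=
          setLIntegral_le_lintegral _ _
      _ ≤ ENNReal.ofReal b * (C1 * ENNReal.ofReal (A ^ (-σ))) := by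
          rw [lintegral_const_mul' _ _ ENNReal.ofReal_ne_top]
          gcongr
          exact hC1 A hA
      _ = _ := by rw [ENNReal.ofReal_mul hb]; ring
  rw [ENNReal.ofReal_add (by positivity) (by positivity)]
  push_cast
  calc _ ≤ _ := add_le_add hin hout
    _ ≤ (C1 + C2) * ENNReal.ofReal (a * A ^ (1 - σ)) +
        (C1 + C2) * ENNReal.ofReal (b * A ^ (-σ)) := by
      gcongr
      · exact le_add_self
      · exact le_self_add
    _ = _ := by ring

/-- The symbol of the singular integral `φ ↦ ∫ (φ (x - y) - φ x) |y|^{-n-σ} dy`. -/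
noncomputable def singularSymbol (σ : ℝ) (ξ : EuclideanSpace ℝ (Fin n)) : ℂ :=
  ∫ y, (Complex.exp (↑(-2 * Real.pi * inner ℝ y ξ) * Complex.I) - 1) *
    ((‖y‖ ^ (-((n : ℝ) + σ)) : ℝ) : ℂ)

lemma norm_exp_sub_one_le (t : ℝ) : ‖Complex.exp (↑t * Complex.I) - 1‖ ≤ |t| := by
  have := Real.norm_exp_I_mul_ofReal_sub_one_le (x := t)
  rwa [mul_comm, Real.norm_eq_abs] at this

lemma norm_exp_sub_one_le_two (t : ℝ) : ‖Complex.exp (↑t * Complex.I) - 1‖ ≤ 2 := by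
  refine (norm_sub_le _ _).trans ?_
  rw [Complex.norm_exp_ofReal_mul_I, norm_one]
  norm_num

lemma enorm_ofReal_of_nonneg {a : ℝ} (ha : 0 ≤ a) : ‖(a : ℂ)‖ₑ = ENNReal.ofReal a := by
  rw [← ofReal_norm, Complex.norm_real, Real.norm_of_nonneg ha]

/-- Here `|e^{it} - 1| ≤ |t|` serves for `‖y‖ ≤ 1` and `|e^{it} - 1| ≤ 2` beyond. Linear growth in
`ξ` is harmless against a Schwartz function. -/
lemma exists_lintegral_exp_sub_one_le (hn : 1 ≤ n) {σ : ℝ} (hσ0 : 0 < σ) (hσ1 : σ < 1) :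
    ∃ C : ℝ≥0, ∀ ξ : EuclideanSpace ℝ (Fin n), ∫⁻ y : EuclideanSpace ℝ (Fin n),
      ‖(Complex.exp (↑(-2 * Real.pi * inner ℝ y ξ) * Complex.I) - 1) *
        ((‖y‖ ^ (-((n : ℝ) + σ)) : ℝ) : ℂ)‖ₑ ≤ C * ENNReal.ofReal (2 * Real.pi * ‖ξ‖ + 2) := by
  obtain ⟨C, hC⟩ := exists_lintegral_mul_kernel_le hn hσ0 hσ1
  refine ⟨C, fun ξ => ?_⟩
  have h := hC (fun y => ‖Complex.exp (↑(-2 * Real.pi * inner ℝ y ξ) * Complex.I) - 1‖ₑ)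
    (2 * Real.pi * ‖ξ‖) 2 1 (by positivity) (by norm_num) one_pos (fun y _ => ?_) (fun y _ => ?_)
  · simp only [Real.one_rpow, mul_one] at h
    refine le_trans (le_of_eq ?_) h
    congr 1
    ext y
    rw [enorm_mul, enorm_ofReal_of_nonneg (by positivity)]
  · rw [← ofReal_norm]
    apply ENNReal.ofReal_le_ofReal
    refine (norm_exp_sub_one_le _).trans ?_
    rw [abs_mul, abs_mul, abs_neg, abs_two, abs_of_pos Real.pi_pos, mul_assoc _ ‖ξ‖, mul_comm ‖ξ‖]
    gcongr
    exact abs_real_inner_le_norm y ξ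
  · rw [← ofReal_norm]
    exact ENNReal.ofReal_le_ofReal (norm_exp_sub_one_le_two _)

lemma measurable_exp_sub_one_mul_kernel (σ : ℝ) (ξ : EuclideanSpace ℝ (Fin n)) :
    Measurable fun y : EuclideanSpace ℝ (Fin n) =>
      (Complex.exp (↑(-2 * Real.pi * inner ℝ y ξ) * Complex.I) - 1) *
        ((‖y‖ ^ (-((n : ℝ) + σ)) : ℝ) : ℂ) := by
  have : Measurable fun y : EuclideanSpace ℝ (Fin n) => inner ℝ y ξ := by fun_prop
  fun_prop

lemma integrable_exp_sub_one_mul_kernel (hn : 1 ≤ n) {σ : ℝ} (hσ0 : 0 < σ) (hσ1 : σ < 1)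
    (ξ : EuclideanSpace ℝ (Fin n)) :
    Integrable (fun y : EuclideanSpace ℝ (Fin n) =>
      (Complex.exp (↑(-2 * Real.pi * inner ℝ y ξ) * Complex.I) - 1) *
        ((‖y‖ ^ (-((n : ℝ) + σ)) : ℝ) : ℂ)) volume := by
  obtain ⟨C, hC⟩ := exists_lintegral_exp_sub_one_le hn hσ0 hσ1
  refine ⟨(measurable_exp_sub_one_mul_kernel σ ξ).aestronglyMeasurable, ?_⟩
  exact (hC ξ).trans_lt (by finiteness)

lemma singularSymbol_comp_isometry (σ : ℝ)
    (T : EuclideanSpace ℝ (Fin n) ≃ₗᵢ[ℝ] EuclideanSpace ℝ (Fin n)) (ξ : EuclideanSpace ℝ (Fin n)) :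
    singularSymbol σ (T ξ) = singularSymbol σ ξ := by
  unfold singularSymbol
  rw [← T.measurePreserving.integral_comp T.toHomeomorph.measurableEmbedding]
  simp

lemma singularSymbol_smul (σ : ℝ) {R : ℝ} (hR : 0 < R) (ξ : EuclideanSpace ℝ (Fin n)) :
    singularSymbol σ (R • ξ) = ((R ^ σ : ℝ) : ℂ) * singularSymbol σ ξ := by
  unfold singularSymbol
  have h := Measure.integral_comp_smul (volume : Measure (EuclideanSpace ℝ (Fin n)))
      (fun y : EuclideanSpace ℝ (Fin n) =>
    (Complex.exp (↑(-2 * Real.pi * inner ℝ y ξ) * Complex.I) - 1) *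
    ((‖y‖ ^ (-((n : ℝ) + σ)) : ℝ) : ℂ)) R
  rw [finrank_euclideanSpace_fin, abs_of_pos (by positivity), Complex.real_smul] at h
  have h2 : ((R ^ σ : ℝ) : ℂ) = ((R ^ ((n : ℝ) + σ) : ℝ) : ℂ) * (((R ^ n)⁻¹ : ℝ) : ℂ) := by
    rw [← Complex.ofReal_mul, Real.rpow_add hR, Real.rpow_natCast]
    congr 1
    field_simp
  rw [h2, mul_assoc, ← h, ← integral_const_mul]
  congr 1
  ext y
  have h3 : ‖y‖ ^ (-((n : ℝ) + σ)) = R ^ ((n : ℝ) + σ) * ‖R • y‖ ^ (-((n : ℝ) + σ)) := by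
    rw [norm_smul, Real.norm_of_nonneg hR.le, Real.mul_rpow hR.le (norm_nonneg _), ← mul_assoc,
      ← Real.rpow_add hR, add_neg_cancel, Real.rpow_zero, one_mul]
  rw [h3, real_inner_smul_left, real_inner_smul_right]
  push_cast
  ring

/-- The symbol is homogeneous of degree `σ` and invariant under linear isometries, and a reflection
carries `e` to the direction of `ξ`. -/
lemma singularSymbol_eq {σ : ℝ} (hσ0 : 0 < σ) {e : EuclideanSpace ℝ (Fin n)} (he : ‖e‖ = 1)
    (ξ : EuclideanSpace ℝ (Fin n)) :
    singularSymbol σ ξ = ((‖ξ‖ ^ σ : ℝ) : ℂ) * singularSymbol σ e := by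
  by_cases hξ : ξ = 0
  · subst hξ
    rw [norm_zero, Real.zero_rpow hσ0.ne']
    simp [singularSymbol]
  · have h0 : 0 < ‖ξ‖ := norm_pos_iff.2 hξ
    have h1 : ξ = ‖ξ‖ • (‖ξ‖⁻¹ • ξ) := by rw [smul_inv_smul₀ h0.ne']
    have h2 : ‖e‖ = ‖‖ξ‖⁻¹ • ξ‖ := by
      rw [norm_smul, norm_inv, norm_norm, inv_mul_cancel₀ h0.ne', he]
    conv_lhs => rw [h1, singularSymbol_smul σ h0, ← Submodule.reflection_sub h2]
    rw [singularSymbol_comp_isometry]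

/-- The real part is minus the integral of a nonnegative function, `1 - cos` times the kernel. That
function is positive on an open set around `e / 2`, where the cosine equals `-1`. -/
lemma singularSymbol_ne_zero (hn : 1 ≤ n) {σ : ℝ} (hσ0 : 0 < σ) (hσ1 : σ < 1)
    {e : EuclideanSpace ℝ (Fin n)}
    (he : ‖e‖ = 1) : singularSymbol σ e ≠ 0 := by
  have hint := integrable_exp_sub_one_mul_kernel hn hσ0 hσ1 e
  have hre : (singularSymbol σ e).re = -∫ y : EuclideanSpace ℝ (Fin n),
      (1 - Real.cos (2 * Real.pi * inner ℝ y e)) *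
      ‖y‖ ^ (-((n : ℝ) + σ)) := by
    unfold singularSymbol
    rw [← integral_neg, ← RCLike.re_eq_complex_re, ← integral_re hint]
    congr 1
    ext y
    rw [RCLike.re_eq_complex_re, Complex.re_mul_ofReal, Complex.sub_re, Complex.one_re,
      Complex.exp_ofReal_mul_I_re, show -2 * Real.pi * inner ℝ y e = -(2 * Real.pi * inner ℝ y e)
      by ring, Real.cos_neg]
    ring
  have hintr : Integrable
      (fun y : EuclideanSpace ℝ (Fin n) => (1 - Real.cos (2 * Real.pi * inner ℝ y e)) *
      ‖y‖ ^ (-((n : ℝ) + σ))) volume := by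
    have := hint.re.neg
    refine this.congr (Filter.Eventually.of_forall fun y => ?_)
    simp only [Pi.neg_apply]
    rw [RCLike.re_eq_complex_re, Complex.re_mul_ofReal, Complex.sub_re, Complex.one_re,
      Complex.exp_ofReal_mul_I_re, show -2 * Real.pi * inner ℝ y e = -(2 * Real.pi * inner ℝ y e)
      by ring, Real.cos_neg]
    ring
  have hpos : 0 < ∫ y : EuclideanSpace ℝ (Fin n), (1 - Real.cos (2 * Real.pi * inner ℝ y e)) *
      ‖y‖ ^ (-((n : ℝ) + σ)) := by
    rw [integral_pos_iff_support_of_nonneg _ hintr]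
    · have hU : IsOpen
          {y : EuclideanSpace ℝ (Fin n) | Real.cos (2 * Real.pi * inner ℝ y e) < 0} := by
        apply isOpen_lt _ continuous_const
        fun_prop
      refine (hU.measure_pos volume ⟨(1 / 2 : ℝ) • e, ?_⟩).trans_le (measure_mono fun y hy => ?_)
      · simp only [Set.mem_ofPred_eq]
        rw [real_inner_smul_left, real_inner_self_eq_norm_sq, he,
          show 2 * Real.pi * (1 / 2 * 1 ^ 2) = Real.pi by ring, Real.cos_pi]
        norm_num
      · simp only [Set.mem_ofPred_eq] at hy
        rw [Function.mem_support]
        have hy0 : y ≠ 0 := by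
          rintro rfl
          rw [inner_zero_left, mul_zero, Real.cos_zero] at hy
          linarith
        have : 0 < ‖y‖ := norm_pos_iff.2 hy0
        have h2 : 0 < 1 - Real.cos (2 * Real.pi * inner ℝ y e) := by linarith
        positivity
    · intro y
      have := Real.cos_le_one (2 * Real.pi * inner ℝ y e)
      have h2 : 0 ≤ 1 - Real.cos (2 * Real.pi * inner ℝ y e) := by linarith
      simp only [Pi.zero_apply]
      positivity
  intro h0
  rw [h0, Complex.zero_re] at hre
  linarith

end FractionalKernel

/-! ### The singular integral of a Schwartz function. -/

section SingularIntegral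

variable {n : ℕ}

lemma lintegral_schwartz_mul_one_add_norm_ne_top (φ : 𝓢(EuclideanSpace ℝ (Fin n), ℂ)) :
    ∫⁻ ξ, ‖φ ξ‖ₑ * ENNReal.ofReal (1 + ‖ξ‖) ≠ ∞ := by
  -- One power absorbs the factor `1 + ‖ξ‖`; the remaining `n + 1` give integrability.
  obtain ⟨B, hB, h1, -⟩ := φ.exists_decay (n + 2)
  have hfin : ∫⁻ ξ : EuclideanSpace ℝ (Fin n), ENNReal.ofReal ((1 + ‖ξ‖) ^ (-((n : ℝ) + 1))) < ∞ :=
    finite_integral_one_add_norm (by rw [finrank_euclideanSpace_fin]; linarith)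
  refine ne_top_of_le_ne_top (ENNReal.mul_ne_top (a := ENNReal.ofReal B) ENNReal.ofReal_ne_top
    hfin.ne) ?_
  rw [← lintegral_const_mul' _ _ ENNReal.ofReal_ne_top]
  apply lintegral_mono
  intro ξ
  dsimp only
  rw [← ofReal_norm, ← ENNReal.ofReal_mul (norm_nonneg _), ← ENNReal.ofReal_mul hB.le]
  apply ENNReal.ofReal_le_ofReal
  have h0 : 0 < 1 + ‖ξ‖ := by positivity
  calc ‖φ ξ‖ * (1 + ‖ξ‖) ≤ B * ((1 + ‖ξ‖) ^ (n + 2))⁻¹ * (1 + ‖ξ‖) := by gcongr; exact h1 ξ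
    _ = _ := by
      rw [Real.rpow_neg h0.le, show (n : ℝ) + 1 = ((n + 1 : ℕ) : ℝ) by push_cast; ring,
        Real.rpow_natCast, pow_succ _ (n + 1)]
      field_simp

/-- The fractional derivative of a Schwartz function as a singular integral. -/
lemma integral_sub_mul_kernel_eq (hn : 1 ≤ n) {σ : ℝ} (hσ0 : 0 < σ) (hσ1 : σ < 1)
    {e : EuclideanSpace ℝ (Fin n)}
    (he : ‖e‖ = 1) (φ : 𝓢(EuclideanSpace ℝ (Fin n), ℂ)) (x : EuclideanSpace ℝ (Fin n)) :
    ∫ y, (φ (x - y) - φ x) * ((‖y‖ ^ (-((n : ℝ) + σ)) : ℝ) : ℂ) =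
      singularSymbol σ e * fracDerivSchwartz σ φ x := by
  set K : EuclideanSpace ℝ (Fin n) → EuclideanSpace ℝ (Fin n) → ℂ := fun ξ y =>
      (Complex.exp (↑(-2 * Real.pi * inner ℝ y ξ) * Complex.I) - 1) *
    ((‖y‖ ^ (-((n : ℝ) + σ)) : ℝ) : ℂ) with hK
  set m : EuclideanSpace ℝ (Fin n) → ℂ := fun ξ => Complex.exp
      (↑(2 * Real.pi * inner ℝ ξ x) * Complex.I) * 𝓕 φ ξ with hm
  have hmc : Continuous m := by
    have : Continuous fun ξ : EuclideanSpace ℝ (Fin n) => inner ℝ ξ x := by fun_prop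
    have h2 := (𝓕 φ).continuous
    fun_prop
  have hme : ∀ ξ, ‖m ξ‖ₑ = ‖𝓕 φ ξ‖ₑ := by
    intro ξ
    rw [hm, enorm_mul, ← ofReal_norm (Complex.exp _), Complex.norm_exp_ofReal_mul_I,
      ENNReal.ofReal_one, one_mul]
  have hKm : Measurable (Function.uncurry K) := by
    have : Measurable fun p : EuclideanSpace ℝ (Fin n) × EuclideanSpace ℝ
        (Fin n) => inner ℝ p.2 p.1 := by fun_prop
    simp only [hK, Function.uncurry_def]
    fun_prop
  -- Fourier inversion writes the increment times the kernel as `∫ m ξ * K ξ y dξ`. Absolute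
  -- convergence of the double integral allows the order to be exchanged, and the `y`-integral then
  -- gives the symbol.
  have hint : Integrable (Function.uncurry fun ξ y => m ξ * K ξ y) (volume.prod volume) := by
    have hmeas : Measurable (Function.uncurry fun ξ y => m ξ * K ξ y) :=
      (hmc.measurable.comp measurable_fst).mul hKm
    refine ⟨hmeas.aestronglyMeasurable, ?_⟩
    obtain ⟨C, hC⟩ := exists_lintegral_exp_sub_one_le hn hσ0 hσ1
    rw [HasFiniteIntegral, lintegral_prod _ hmeas.enorm.aemeasurable]
    refine lt_of_le_of_lt ?_ (ENNReal.mul_lt_top (a := C * ENNReal.ofReal (2 * Real.pi + 2))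
      (by finiteness) (lintegral_schwartz_mul_one_add_norm_ne_top (𝓕 φ)).lt_top)
    rw [← lintegral_const_mul' _ _ (by finiteness)]
    apply lintegral_mono
    intro ξ
    simp only [Function.uncurry_apply_pair, enorm_mul (m ξ)]
    rw [lintegral_const_mul' _ _ (by finiteness), hme, mul_left_comm]
    gcongr
    refine (hC ξ).trans ?_
    rw [mul_assoc (C : ℝ≥0∞), ← ENNReal.ofReal_mul (by positivity)]
    gcongr
    have := Real.pi_pos
    nlinarith [norm_nonneg ξ]
  have hphi : ∀ y, (φ (x - y) - φ x) * ((‖y‖ ^ (-((n : ℝ) + σ)) : ℝ) : ℂ) = ∫ ξ, m ξ * K ξ y := by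
    intro y
    have hinv : ∀ z, φ z = ∫ ξ, Complex.exp (↑(2 * Real.pi * inner ℝ ξ z) * Complex.I) * 𝓕 φ ξ := by
      intro z
      have h1 : 𝓕⁻ (𝓕 φ) = φ := by simp
      have h2 : (𝓕⁻ (𝓕 φ)) z = φ z := by rw [h1]
      rw [SchwartzMap.fourierInv_coe, Real.fourierInv_eq'] at h2
      exact h2.symm
    have hi : ∀ z, Integrable (fun ξ => Complex.exp (↑(2 * Real.pi * inner ℝ ξ z) * Complex.I) *
        𝓕 φ ξ) volume := by
      intro z
      refine (𝓕 φ).integrable.bdd_mul (c := 1) ?_ (Filter.Eventually.of_forall fun ξ => ?_)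
      · have : Continuous fun ξ : EuclideanSpace ℝ (Fin n) => inner ℝ ξ z := by fun_prop
        exact Continuous.aestronglyMeasurable (by fun_prop)
      · rw [Complex.norm_exp_ofReal_mul_I]
    rw [hinv (x - y), hinv x, ← integral_sub (hi _) (hi _), ← integral_mul_const]
    congr 1
    ext ξ
    simp only [hm, hK]
    rw [inner_sub_right, real_inner_comm y ξ,
      show ((2 * Real.pi * (inner ℝ ξ x - inner ℝ y ξ) : ℝ) : ℂ) * Complex.I =
      ((2 * Real.pi * inner ℝ ξ x : ℝ) : ℂ) * Complex.I +
      ((-2 * Real.pi * inner ℝ y ξ : ℝ) : ℂ) * Complex.I by push_cast; ring, Complex.exp_add]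
    ring
  simp only [hphi]
  rw [← integral_integral_swap hint]
  have hJ : ∀ ξ, ∫ y, m ξ * K ξ y = singularSymbol σ e *
      (Complex.exp (↑(2 * Real.pi * inner ℝ ξ x) * Complex.I) *
      (((‖ξ‖ ^ σ : ℝ) : ℂ) * 𝓕 φ ξ)) := by
    intro ξ
    rw [integral_const_mul]
    have : ∫ y, K ξ y = singularSymbol σ ξ := rfl
    rw [this, singularSymbol_eq hσ0 he]
    simp only [hm]
    ring
  simp only [hJ]
  rw [integral_const_mul]
  unfold fracDerivSchwartz
  rw [Real.fourierInv_eq']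
  rfl

/-- Weighted bound for the singular integral of a Schwartz function. -/
lemma exists_lintegral_sub_mul_kernel_le (hn : 1 ≤ n) {σ : ℝ} (hσ0 : 0 < σ) (hσ1 : σ < 1)
    (φ : 𝓢(EuclideanSpace ℝ (Fin n), ℂ)) :
    ∃ C : ℝ≥0, ∀ x : EuclideanSpace ℝ (Fin n), ∫⁻ y, ‖φ (x - y) - φ x‖ₑ * ENNReal.ofReal
        (‖y‖ ^ (-((n : ℝ) + σ))) ≤
      C * ENNReal.ofReal ((1 + ‖x‖) ^ (-((n : ℝ) + σ))) := by
  obtain ⟨C, hC⟩ := exists_lintegral_mul_kernel_le hn hσ0 hσ1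
  obtain ⟨B, hB, h1, h2⟩ := φ.exists_decay (n + 1)
  set I := ∫⁻ z, ‖φ z‖ₑ with hI
  have hItop : I ≠ ∞ := φ.integrable.2.ne
  set b : ℝ := 2 ^ ((n : ℝ) + σ) with hb
  set P : ℝ := 2 ^ (n + 1) with hP
  have hP1 : 1 ≤ P := one_le_pow₀ one_le_two
  refine ⟨C * (B * (P + 1) * 2 + B * b).toNNReal + (I * ENNReal.ofReal b).toNNReal, fun x => ?_⟩
  set X := 1 + ‖x‖ with hX
  have hX1 : 1 ≤ X := by simp [hX]
  have hX0 : 0 < X := by linarith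
  set ρ := X / 2 with hρ
  have hρ0 : 0 < ρ := by positivity
  -- For `‖y‖ > ρ` the kernel is already of the target size `X ^ (-(n + σ))`, and `φ (x - y)` is
  -- integrated in `y`. For `‖y‖ ≤ ρ` the point `x - y` still satisfies `X ≤ 2 (1 + ‖x - y‖)`, so
  -- `φ` is small there.
  have hsplit : ∀ y, ‖φ (x - y) - φ x‖ₑ * ENNReal.ofReal (‖y‖ ^ (-((n : ℝ) + σ))) ≤
      (if ‖y‖ ≤ ρ then ‖φ (x - y) - φ x‖ₑ else ‖φ x‖ₑ) *
        ENNReal.ofReal (‖y‖ ^ (-((n : ℝ) + σ))) +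
      ‖φ (x - y)‖ₑ * ENNReal.ofReal (b * X ^ (-((n : ℝ) + σ))) := by
    intro y
    split_ifs with hy
    · exact le_self_add
    · rw [not_le] at hy
      calc _ ≤ (‖φ (x - y)‖ₑ + ‖φ x‖ₑ) * ENNReal.ofReal (‖y‖ ^ (-((n : ℝ) + σ))) := by
            gcongr
            exact enorm_sub_le
        _ = ‖φ x‖ₑ * ENNReal.ofReal (‖y‖ ^ (-((n : ℝ) + σ))) +
            ‖φ (x - y)‖ₑ * ENNReal.ofReal (‖y‖ ^ (-((n : ℝ) + σ))) := by ring
        _ ≤ _ := by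
            gcongr
            calc ‖y‖ ^ (-((n : ℝ) + σ)) ≤ ρ ^ (-((n : ℝ) + σ)) :=
                  Real.rpow_le_rpow_of_nonpos hρ0 hy.le (by linarith [(n.cast_nonneg : (0:ℝ) ≤ n)])
              _ = _ := by
                  rw [hρ, hb, Real.div_rpow hX0.le two_pos.le, Real.rpow_neg two_pos.le]
                  field_simp
  have hpow : ∀ v : ℝ, X ≤ 2 * v → ((v) ^ (n + 1))⁻¹ ≤ P * (X ^ (n + 1))⁻¹ := by
    intro v hv
    have hv0 : 0 < v := by linarith
    rw [← div_eq_mul_inv, le_div_iff₀ (by positivity), ← div_eq_inv_mul,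
      div_le_iff₀ (by positivity), hP, ← mul_pow]
    gcongr
  have hnear := hC (fun y => if ‖y‖ ≤ ρ then ‖φ (x - y) - φ x‖ₑ else ‖φ x‖ₑ)
    (B * (P + 1) * (X ^ (n + 1))⁻¹) (B * (X ^ (n + 1))⁻¹) ρ (by positivity) (by positivity) hρ0
    (fun y hy => ?_) (fun y hy => ?_)
  · calc _ ≤ _ := lintegral_mono hsplit
      _ = (∫⁻ y, (if ‖y‖ ≤ ρ then ‖φ (x - y) - φ x‖ₑ else ‖φ x‖ₑ) *
            ENNReal.ofReal (‖y‖ ^ (-((n : ℝ) + σ)))) +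
            ENNReal.ofReal (b * X ^ (-((n : ℝ) + σ))) * I := by
          rw [lintegral_add_right, lintegral_mul_const' _ _ ENNReal.ofReal_ne_top, mul_comm]
          · rw [hI, lintegral_sub_left_eq_self (fun y => ‖φ y‖ₑ) x]
          · exact ((φ.continuous.measurable.comp
              (measurable_const.sub measurable_id)).enorm).mul_const _
      _ ≤ C * ENNReal.ofReal ((B * (P + 1) * 2 + B * b) * X ^ (-((n : ℝ) + σ))) +
            ENNReal.ofReal (b * X ^ (-((n : ℝ) + σ))) * I := by
          gcongr
          refine hnear.trans ?_
          gcongr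
          have e1 : (X ^ (n + 1))⁻¹ * X ^ (1 - σ) = X ^ (-((n : ℝ) + σ)) := by
            rw [← Real.rpow_natCast, ← Real.rpow_neg hX0.le, ← Real.rpow_add hX0]
            congr 1
            push_cast
            ring
          have e2 : (X ^ (n + 1))⁻¹ * X ^ (-σ) ≤ X ^ (-((n : ℝ) + σ)) := by
            rw [← e1]
            gcongr
            linarith
          have e3 : ρ ^ (1 - σ) ≤ 2 * X ^ (1 - σ) := by
            have : ρ ^ (1 - σ) ≤ X ^ (1 - σ) := by
              apply Real.rpow_le_rpow hρ0.le _ (by linarith)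
              rw [hρ]; linarith
            have h0 : 0 ≤ X ^ (1 - σ) := by positivity
            linarith
          have e4 : ρ ^ (-σ) ≤ b * X ^ (-σ) := by
            rw [hρ, Real.div_rpow hX0.le two_pos.le, Real.rpow_neg two_pos.le, div_inv_eq_mul,
              mul_comm]
            gcongr
            · rw [hb]
              exact Real.rpow_le_rpow_of_exponent_le one_le_two
                (by linarith [(n.cast_nonneg : (0:ℝ) ≤ n)])
          calc _ ≤ B * (P + 1) * (X ^ (n + 1))⁻¹ * (2 * X ^ (1 - σ)) +
                B * (X ^ (n + 1))⁻¹ * (b * X ^ (-σ)) := by gcongr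
            _ = B * (P + 1) * 2 * ((X ^ (n + 1))⁻¹ * X ^ (1 - σ)) +
                B * b * ((X ^ (n + 1))⁻¹ * X ^ (-σ)) := by ring
            _ ≤ B * (P + 1) * 2 * X ^ (-((n : ℝ) + σ)) + B * b * X ^ (-((n : ℝ) + σ)) := by
                rw [e1]
                gcongr
            _ = _ := by ring
      _ = _ := by
          rw [ENNReal.ofReal_mul (by positivity), ENNReal.ofReal_mul (by positivity)]
          push_cast
          rw [ENNReal.coe_toNNReal (ENNReal.mul_ne_top hItop ENNReal.ofReal_ne_top),
            ← ENNReal.ofReal]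
          ring
  · simp only [hy, if_true]
    rw [← ofReal_norm]
    apply ENNReal.ofReal_le_ofReal
    rcases le_total ‖y‖ 1 with hy1 | hy1
    · have := h2 x (x - y) (by simpa using hy1)
      rw [sub_sub_cancel_left, norm_neg] at this
      calc _ ≤ _ := this
        _ = B * 1 * (X ^ (n + 1))⁻¹ * ‖y‖ := by rw [hX]; ring
        _ ≤ _ := by gcongr; linarith
    · calc _ ≤ ‖φ (x - y)‖ + ‖φ x‖ := norm_sub_le _ _
        _ ≤ B * (P * (X ^ (n + 1))⁻¹) + B * (X ^ (n + 1))⁻¹ := by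
            gcongr
            · refine (h1 (x - y)).trans ?_
              gcongr
              apply hpow
              have := norm_sub_norm_le x y
              rw [hρ] at hy
              linarith
            · exact h1 x
        _ = B * (P + 1) * (X ^ (n + 1))⁻¹ * 1 := by ring
        _ ≤ _ := by gcongr
  · simp only [not_le.2 hy, if_false]
    rw [← ofReal_norm]
    exact ENNReal.ofReal_le_ofReal (h1 x)

end SingularIntegral

/-! ### From increments of `f` to its fractional derivative. -/

section Duality

variable {n : ℕ}

/-- The shear `(x, y) ↦ (x, x + y)` preserves the product measure, so null sets pull back to null
sets. -/
lemma aestronglyMeasurable_comp_add {f : EuclideanSpace ℝ (Fin n) → ℂ}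
    (hf : AEStronglyMeasurable f volume) :
    AEStronglyMeasurable
      (fun p : EuclideanSpace ℝ (Fin n) × EuclideanSpace ℝ (Fin n) => f (p.1 + p.2))
          (volume.prod volume) := by
  have h1 : AEStronglyMeasurable
      (fun p : EuclideanSpace ℝ (Fin n) × EuclideanSpace ℝ (Fin n) => f p.2)
          (volume.prod volume) := hf.comp_snd
  exact h1.comp_measurePreserving (measurePreserving_prod_add volume volume)

/-- Up to a constant, the fractional derivative of `f` of order `σ ∈ (0,1)` is the singular integral
of the increments of `f`, when the latter converges absolutely. -/
lemma exists_hasFracDeriv_singularIntegral (hn : 1 ≤ n) {σ : ℝ} (hσ0 : 0 < σ) (hσ1 : σ < 1) :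
    ∃ c : ℂ, ∀ f : EuclideanSpace ℝ (Fin n) → ℂ,
      Integrable (fun x => (((1 + ‖x‖) ^ (-((n : ℝ) + σ)) : ℝ) : ℂ) * f x) volume →
      (∀ φ : 𝓢(EuclideanSpace ℝ (Fin n), ℂ), ∫⁻ x, (∫⁻ y, ‖f (x + y) - f x‖ₑ *
        ENNReal.ofReal (‖y‖ ^ (-((n : ℝ) + σ)))) * ‖φ x‖ₑ ≠ ∞) →
      HasFracDeriv σ f (fun x => c * ∫ y, (f (x + y) - f x) *
        ((‖y‖ ^ (-((n : ℝ) + σ)) : ℝ) : ℂ)) := by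
  have hne : Nonempty (Fin n) := ⟨⟨0, by omega⟩⟩
  obtain ⟨i⟩ := hne
  set e : EuclideanSpace ℝ (Fin n) := EuclideanSpace.single i 1 with he_def
  have he : ‖e‖ = 1 := by simp [he_def]
  set J := singularSymbol σ e with hJ
  have hJ0 : J ≠ 0 := singularSymbol_ne_zero hn hσ0 hσ1 he
  refine ⟨J⁻¹, fun f hf hD => ⟨hf, fun φ => ?_⟩⟩
  set k : EuclideanSpace ℝ (Fin n) → ℂ := fun y => ((‖y‖ ^ (-((n : ℝ) + σ)) : ℝ) : ℂ) with hk
  have hkm : Measurable k := by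
    simp only [hk]
    fun_prop
  have hke : ∀ y, ‖k y‖ₑ = ENNReal.ofReal (‖y‖ ^ (-((n : ℝ) + σ))) := fun y =>
    enorm_ofReal_of_nonneg (by positivity)
  have hfm : AEStronglyMeasurable f volume :=
      (locallyIntegrable_of_weighted hf).aestronglyMeasurable
  have hcn : (n : ℝ) + σ ≤ n + 1 := by linarith
  have hfφ : ∀ y, Integrable (fun x => f x * φ (x - y)) volume := by
    intro y
    have := integrable_mul_dilate hcn hf φ one_pos y
    simpa using this
  have hfφ' : ∀ y, Integrable (fun x => f (x + y) * φ x) volume := by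
    intro y
    have := (hfφ y).comp_add_right y
    simpa using this
  -- The two double integrals converge for different reasons: this one by the assumption on the
  -- increments of `f`, the next by the weighted integrability of `f` and the decay of the singular
  -- integral of `φ`.
  have hI1 : Integrable (Function.uncurry fun x y => (f (x + y) - f x) * k y * φ x)
      (volume.prod volume) := by
    have hmeas : AEStronglyMeasurable (Function.uncurry fun x y => (f (x + y) - f x) * k y * φ x)
        (volume.prod volume) :=
      (((aestronglyMeasurable_comp_add hfm).sub hfm.comp_fst).mul
        (hkm.comp measurable_snd).aestronglyMeasurable).mul
        (φ.continuous.measurable.comp measurable_fst).aestronglyMeasurable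
    refine ⟨hmeas, ?_⟩
    rw [HasFiniteIntegral, lintegral_prod _ hmeas.enorm]
    refine lt_of_le_of_lt (le_of_eq ?_) (hD φ).lt_top
    congr 1
    ext x
    simp only [Function.uncurry_apply_pair, enorm_mul, hke]
    rw [lintegral_mul_const' _ _ enorm_ne_top]
  have hI2 : Integrable (Function.uncurry fun x y => f x * ((φ (x - y) - φ x) * k y))
      (volume.prod volume) := by
    have hmeas : AEStronglyMeasurable (Function.uncurry fun x y => f x * ((φ (x - y) - φ x) * k y))
        (volume.prod volume) := by
      refine hfm.comp_fst.mul (Measurable.aestronglyMeasurable ?_)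
      exact ((φ.continuous.measurable.comp (measurable_fst.sub measurable_snd)).sub
        (φ.continuous.measurable.comp measurable_fst)).mul (hkm.comp measurable_snd)
    refine ⟨hmeas, ?_⟩
    obtain ⟨C, hC⟩ := exists_lintegral_sub_mul_kernel_le hn hσ0 hσ1 φ
    rw [HasFiniteIntegral, lintegral_prod _ hmeas.enorm]
    refine lt_of_le_of_lt ?_ (ENNReal.mul_lt_top (a := C) ENNReal.coe_lt_top
      (lintegral_weighted_ne_top hf).lt_top)
    rw [← lintegral_const_mul' _ _ ENNReal.coe_ne_top]
    apply lintegral_mono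
    intro x
    simp only [Function.uncurry_apply_pair, enorm_mul (f x)]
    rw [lintegral_const_mul' _ _ enorm_ne_top, mul_left_comm]
    gcongr
    simp only [enorm_mul, hke]
    exact hC x
  have hpt : ∀ x, (∫ y, (f (x + y) - f x) * k y * φ x) = (∫ y, (f (x + y) - f x) * k y) * φ x :=
    fun x => integral_mul_const _ _
  constructor
  · have h1 := hI1.integral_prod_left
    simp only [Function.uncurry_apply_pair, hpt] at h1
    refine (h1.const_mul J⁻¹).congr (Filter.Eventually.of_forall fun x => ?_)
    simp only [mul_assoc]
    rfl
  · change ∫ x, f x * fracDerivSchwartz σ φ x =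
      ∫ x, (J⁻¹ * ∫ y, (f (x + y) - f x) * k y) * φ x
    have h2 : ∀ x, f x * fracDerivSchwartz σ φ x =
        J⁻¹ * ∫ y, f x * ((φ (x - y) - φ x) * k y) := by
      intro x
      rw [integral_const_mul, integral_sub_mul_kernel_eq hn hσ0 hσ1 he φ x, ← hJ]
      field_simp
    have h5 : ∀ x, (J⁻¹ * ∫ y, (f (x + y) - f x) * k y) * φ x =
        J⁻¹ * ∫ y, (f (x + y) - f x) * k y * φ x := fun x => by rw [hpt, mul_assoc]
    simp only [h2, h5]
    -- With the `x`-integral inside, the identity holds for each fixed `y` by the translation `x ↦ x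
    -- + y`.
    rw [integral_const_mul, integral_const_mul, integral_integral_swap hI2,
      integral_integral_swap hI1]
    congr 2
    ext y
    have h3 : ∀ x, f x * ((φ (x - y) - φ x) * k y) = k y * (f x * φ (x - y) - f x * φ x) :=
      fun x => by ring
    have h4 : ∀ x, (f (x + y) - f x) * k y * φ x = k y * (f (x + y) * φ x - f x * φ x) :=
      fun x => by ring
    simp only [h3, h4]
    have h0 : Integrable (fun x => f x * φ x) volume := by simpa using hfφ 0
    rw [integral_const_mul, integral_const_mul, integral_sub (hfφ y) h0, integral_sub (hfφ' y) h0,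
      ← integral_add_right_eq_self (fun x => f x * φ (x - y)) y]
    simp

end Duality

/-! ### Choice of the splitting radius and the pointwise estimate. -/

/-- Optimizing `A ^ β * G + A ^ (-σ) * H` in `A`. -/
lemma ENNReal.le_rpow_mul_rpow_of_forall_le {D c G H : ℝ≥0∞} {β σ : ℝ} (hβ : 0 < β) (hσ : 0 < σ)
    (hc : c ≠ ∞) (hG : G ≠ ∞) (hH : H ≠ ∞)
    (h : ∀ A : ℝ, 0 < A → D ≤ c * (ENNReal.ofReal (A ^ β) * G + ENNReal.ofReal (A ^ (-σ)) * H)) :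
    D ≤ 2 * c * (G ^ (σ / (β + σ)) * H ^ (β / (β + σ))) := by
  have hs : 0 < β + σ := by linarith
  have hlim1 : Filter.Tendsto (fun A : ℝ => ENNReal.ofReal (A ^ (-σ))) Filter.atTop (nhds 0) := by
    rw [← ENNReal.ofReal_zero]
    exact ENNReal.tendsto_ofReal (tendsto_rpow_neg_atTop hσ)
  have hlim2 : Filter.Tendsto (fun A : ℝ => ENNReal.ofReal ((A⁻¹) ^ β)) Filter.atTop (nhds 0) := by
    rw [← ENNReal.ofReal_zero]
    apply ENNReal.tendsto_ofReal
    refine (tendsto_rpow_neg_atTop hβ).congr' ?_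
    filter_upwards [Filter.eventually_gt_atTop (0 : ℝ)] with A hA
    rw [Real.rpow_neg hA.le, Real.inv_rpow hA.le]
  -- If `G` or `H` vanishes there is no optimal `A`; letting `A → ∞`, respectively `A → 0`, shows `D
  -- = 0`.
  by_cases hG0 : G = 0
  · have h1 : Filter.Tendsto (fun A : ℝ => c * (ENNReal.ofReal (A ^ (-σ)) * H)) Filter.atTop
        (nhds (c * (0 * H))) :=
      ENNReal.Tendsto.const_mul (ENNReal.Tendsto.mul_const hlim1 (Or.inr hH)) (Or.inr hc)
    rw [zero_mul, mul_zero] at h1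
    refine (ge_of_tendsto h1 ?_).trans zero_le
    filter_upwards [Filter.eventually_gt_atTop (0 : ℝ)] with A hA
    simpa [hG0] using h A hA
  by_cases hH0 : H = 0
  · have h1 : Filter.Tendsto (fun A : ℝ => c * (ENNReal.ofReal (A⁻¹ ^ β) * G)) Filter.atTop
        (nhds (c * (0 * G))) :=
      ENNReal.Tendsto.const_mul (ENNReal.Tendsto.mul_const hlim2 (Or.inr hG)) (Or.inr hc)
    rw [zero_mul, mul_zero] at h1
    refine (ge_of_tendsto h1 ?_).trans zero_le
    filter_upwards [Filter.eventually_gt_atTop (0 : ℝ)] with A hA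
    simpa [hH0] using h A⁻¹ (inv_pos.2 hA)
  have hGr : 0 < G.toReal := ENNReal.toReal_pos hG0 hG
  have hHr : 0 < H.toReal := ENNReal.toReal_pos hH0 hH
  set a := G.toReal
  set b := H.toReal
  have hGa : G = ENNReal.ofReal a := (ENNReal.ofReal_toReal hG).symm
  have hHb : H = ENNReal.ofReal b := (ENNReal.ofReal_toReal hH).symm
  -- This `A` makes the two terms equal, whence the factor `2`.
  set A : ℝ := (b / a) ^ (1 / (β + σ)) with hA
  have hA0 : 0 < A := by positivity
  have e1 : A ^ β * a = a ^ (σ / (β + σ)) * b ^ (β / (β + σ)) := by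
    rw [hA, ← Real.rpow_mul (by positivity), Real.div_rpow hHr.le hGr.le,
      show σ / (β + σ) = 1 - 1 / (β + σ) * β by field_simp; ring, Real.rpow_sub hGr, Real.rpow_one,
      show β / (β + σ) = 1 / (β + σ) * β by ring]
    field_simp
  have e2 : A ^ (-σ) * b = a ^ (σ / (β + σ)) * b ^ (β / (β + σ)) := by
    rw [hA, ← Real.rpow_mul (by positivity), Real.div_rpow hHr.le hGr.le,
      show β / (β + σ) = 1 - 1 / (β + σ) * σ by field_simp; ring, Real.rpow_sub hHr, Real.rpow_one,
      show σ / (β + σ) = 1 / (β + σ) * σ by ring, mul_neg, Real.rpow_neg hHr.le,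
      Real.rpow_neg hGr.le]
    field_simp
  refine (h A hA0).trans (le_of_eq ?_)
  rw [hGa, hHb, ← ENNReal.ofReal_mul (by positivity), ← ENNReal.ofReal_mul (by positivity), e1, e2,
    ENNReal.ofReal_rpow_of_pos hGr, ENNReal.ofReal_rpow_of_pos hHr,
    ← ENNReal.ofReal_mul (by positivity)]
  ring

section Pointwise

variable {n : ℕ}

/-- The integrated increments of `f` are controlled by maximal functions, if the increments of `f`
satisfy a Hölder type bound and a bound by the size. -/
lemma exists_lintegral_increment_le (hn : 1 ≤ n) {σ τ : ℝ} (hσ0 : 0 < σ) (hστ : σ < τ)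
    (hτ1 : τ < 1) :
    ∃ C : ℝ≥0, ∀ (f : EuclideanSpace ℝ (Fin n) → ℂ) (G U : EuclideanSpace ℝ (Fin n) → ℝ≥0∞)
        (a : ℝ≥0), AEMeasurable G volume →
      AEMeasurable U volume → ∀ x : EuclideanSpace ℝ (Fin n),
      (∀ᵐ z, ‖f z - f x‖ₑ ≤ a * (ENNReal.ofReal (‖z - x‖ ^ τ) * (G z + G x))) →
      (∀ᵐ z, ‖f z - f x‖ₑ ≤ a * (U z + U x)) →
      maximalFn volume G x + G x ≠ ∞ → maximalFn volume U x + U x ≠ ∞ →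
      ∫⁻ y, ‖f (x + y) - f x‖ₑ * ENNReal.ofReal (‖y‖ ^ (-((n : ℝ) + σ))) ≤
        C * a * ((maximalFn volume G x + G x) ^ (σ / τ) *
          (maximalFn volume U x + U x) ^ (1 - σ / τ)) := by
  have hn' : (1 : ℝ) ≤ n := by exact_mod_cast hn
  set β := τ - σ with hβ
  have hβ0 : 0 < β := by linarith
  obtain ⟨C1, hC1⟩ := exists_lintegral_mul_max_rpow_le n hσ0
  obtain ⟨C2, hC2⟩ := exists_setLIntegral_mul_norm_rpow_le n hβ0 (by linarith)
  have hconst : ∀ (b : ℝ≥0∞) (x : EuclideanSpace ℝ (Fin n)), maximalFn volume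
      (fun _ => b) x ≤ b := by
    intro b x
    apply iSup_le
    intro k
    rw [ENNReal.div_le_iff (measure_closedBall_two_zpow_ne_zero x k)
      (measure_closedBall_ne_top' x _), setLIntegral_const]
  refine ⟨2 * (C1 + C2), fun f G U a hG hU x h1 h2 hGx hUx => ?_⟩
  have hopt := ENNReal.le_rpow_mul_rpow_of_forall_le (D := ∫⁻ y, ‖f (x + y) - f x‖ₑ *
    ENNReal.ofReal (‖y‖ ^ (-((n : ℝ) + σ)))) (c := (C1 + C2 : ℝ≥0) * a) hβ0 hσ0 (by finiteness)
    hGx hUx ?_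
  · refine hopt.trans_eq ?_
    have e1 : β + σ = τ := by rw [hβ]; ring
    have e2 : β / τ = 1 - σ / τ := by
      rw [hβ, sub_div, div_self (by linarith)]
    rw [e1, e2]
    push_cast
    ring
  intro A hA
  have hshift : ∫⁻ y, ‖f (x + y) - f x‖ₑ * ENNReal.ofReal (‖y‖ ^ (-((n : ℝ) + σ))) =
      ∫⁻ z, ‖f z - f x‖ₑ * ENNReal.ofReal (‖z - x‖ ^ (-((n : ℝ) + σ))) := by
    rw [← lintegral_add_left_eq_self (fun z => ‖f z - f x‖ₑ *
      ENNReal.ofReal (‖z - x‖ ^ (-((n : ℝ) + σ)))) x]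
    simp
  rw [hshift, ← lintegral_add_compl _ (Metric.isClosed_closedBall (x := x) (ε := A)).measurableSet]
  have hin : ∫⁻ z in Metric.closedBall x A, ‖f z - f x‖ₑ *
      ENNReal.ofReal (‖z - x‖ ^ (-((n : ℝ) + σ))) ≤
      a * (C2 * (ENNReal.ofReal (A ^ β) * (maximalFn volume G x + G x))) := by
    calc _ ≤ ∫⁻ z in Metric.closedBall x A,
          a * (G z * ENNReal.ofReal (‖z - x‖ ^ (-((n : ℝ) - β))) +
            G x * ENNReal.ofReal (‖z - x‖ ^ (-((n : ℝ) - β)))) := by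
          apply lintegral_mono_ae
          filter_upwards [ae_restrict_of_ae h1] with z hz
          -- The Hölder gain makes the kernel locally integrable, with exponent `-(n - β)` and `β =
          -- τ - σ > 0`. At `z = x` both sides are `0`.
          have hk : ‖z - x‖ ^ τ * ‖z - x‖ ^ (-((n : ℝ) + σ)) = ‖z - x‖ ^ (-((n : ℝ) - β)) := by
            rcases (norm_nonneg (z - x)).eq_or_lt with h | h
            · rw [← h, Real.zero_rpow (by linarith), zero_mul, Real.zero_rpow (by linarith)]
            · rw [← Real.rpow_add h]
              congr 1
              rw [hβ]
              ring
          calc _ ≤ a * (ENNReal.ofReal (‖z - x‖ ^ τ) * (G z + G x)) *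
                ENNReal.ofReal (‖z - x‖ ^ (-((n : ℝ) + σ))) := by gcongr
            _ = a * ((G z + G x) * (ENNReal.ofReal (‖z - x‖ ^ τ) *
                ENNReal.ofReal (‖z - x‖ ^ (-((n : ℝ) + σ))))) := by ring
            _ = _ := by
                rw [← ENNReal.ofReal_mul (by positivity), hk, add_mul]
      _ = a * ((∫⁻ z in Metric.closedBall x A,
            G z * ENNReal.ofReal (‖z - x‖ ^ (-((n : ℝ) - β)))) +
            ∫⁻ z in Metric.closedBall x A, G x * ENNReal.ofReal (‖z - x‖ ^ (-((n : ℝ) - β)))) := by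
          rw [lintegral_const_mul' _ _ ENNReal.coe_ne_top, lintegral_add_right]
          fun_prop
      _ ≤ a * (C2 * ENNReal.ofReal (A ^ β) * maximalFn volume G x +
            C2 * ENNReal.ofReal (A ^ β) * G x) := by
          gcongr
          · exact hC2 G hG x A hA
          · refine (hC2 (fun _ => G x) aemeasurable_const x A hA).trans ?_
            gcongr
            exact hconst _ _
      _ = _ := by ring
  have hout : ∫⁻ z in (Metric.closedBall x A)ᶜ, ‖f z - f x‖ₑ *
      ENNReal.ofReal (‖z - x‖ ^ (-((n : ℝ) + σ))) ≤
      a * (C1 * (ENNReal.ofReal (A ^ (-σ)) * (maximalFn volume U x + U x))) := by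
    calc _ ≤ ∫⁻ z in (Metric.closedBall x A)ᶜ,
          a * (U z * ENNReal.ofReal ((max ‖z - x‖ A) ^ (-((n : ℝ) + σ))) +
            U x * ENNReal.ofReal ((max ‖z - x‖ A) ^ (-((n : ℝ) + σ)))) := by
          apply lintegral_mono_ae
          filter_upwards [ae_restrict_of_ae h2,
            ae_restrict_mem Metric.isClosed_closedBall.measurableSet.compl] with z hz hzA
          rw [Set.mem_compl_iff, Metric.mem_closedBall, dist_eq_norm, not_le] at hzA
          rw [max_eq_left hzA.le, ← add_mul, ← mul_assoc]
          gcongr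
      _ ≤ ∫⁻ z, a * (U z * ENNReal.ofReal ((max ‖z - x‖ A) ^ (-((n : ℝ) + σ))) +
            U x * ENNReal.ofReal ((max ‖z - x‖ A) ^ (-((n : ℝ) + σ)))) :=
          setLIntegral_le_lintegral _ _
      _ = a * ((∫⁻ z, U z * ENNReal.ofReal ((max ‖z - x‖ A) ^ (-((n : ℝ) + σ)))) +
            ∫⁻ z, U x * ENNReal.ofReal ((max ‖z - x‖ A) ^ (-((n : ℝ) + σ)))) := by
          rw [lintegral_const_mul' _ _ ENNReal.coe_ne_top, lintegral_add_right]
          fun_prop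
      _ ≤ a * (C1 * ENNReal.ofReal (A ^ (-σ)) * maximalFn volume U x +
            C1 * ENNReal.ofReal (A ^ (-σ)) * U x) := by
          gcongr
          · exact hC1 U hU x A hA
          · refine (hC1 (fun _ => U x) aemeasurable_const x A hA).trans ?_
            gcongr
            exact hconst _ _
      _ = _ := by ring
  calc _ ≤ _ := add_le_add hin hout
    _ ≤ a * ((C1 + C2) * (ENNReal.ofReal (A ^ β) * (maximalFn volume G x + G x))) +
        a * ((C1 + C2) * (ENNReal.ofReal (A ^ (-σ)) * (maximalFn volume U x + U x))) := by
      gcongr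
      · exact le_add_self
      · exact le_self_add
    _ = _ := by push_cast; ring

/-- Finiteness of the maximal function at one point bounds the integral against the kernel centred
there with `A = 1`, and that kernel dominates the weight. The `1` in `1 + U z` allows for a nonzero
value of `F` at the origin. -/
lemma integrable_weighted_of_maximalFn_ne_top {σ : ℝ} (hσ0 : 0 < σ)
    {f : EuclideanSpace ℝ (Fin n) → ℂ}
    (hf : AEStronglyMeasurable f volume) {U : EuclideanSpace ℝ (Fin n) → ℝ≥0∞}
      (hU : AEMeasurable U volume) (b : ℝ≥0)
    (hfU : ∀ z, ‖f z‖ₑ ≤ b * (1 + U z)) {x : EuclideanSpace ℝ (Fin n)}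
      (hx : maximalFn volume U x ≠ ∞) :
    Integrable (fun z => (((1 + ‖z‖) ^ (-((n : ℝ) + σ)) : ℝ) : ℂ) * f z) volume := by
  obtain ⟨C, hC⟩ := exists_lintegral_mul_max_rpow_le n hσ0
  refine ⟨(continuous_one_add_norm_rpow _).aestronglyMeasurable.mul hf, ?_⟩
  have hw : ∀ z : EuclideanSpace ℝ (Fin n), (1 + ‖z‖) ^ (-((n : ℝ) + σ)) ≤
      (1 + ‖x‖) ^ ((n : ℝ) + σ) * (max ‖z - x‖ 1) ^ (-((n : ℝ) + σ)) := by
    intro z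
    have hm : 0 < max ‖z - x‖ 1 := lt_max_of_lt_right one_pos
    have h1 : max ‖z - x‖ 1 ≤ (1 + ‖x‖) * (1 + ‖z‖) := by
      have := norm_sub_le z x
      have hp : 0 ≤ ‖x‖ * ‖z‖ := by positivity
      apply max_le <;> nlinarith [norm_nonneg x, norm_nonneg z]
    rw [Real.rpow_neg (by positivity), Real.rpow_neg hm.le, ← div_eq_mul_inv,
      le_div_iff₀ (by positivity), ← div_eq_inv_mul, div_le_iff₀ (by positivity),
      ← Real.mul_rpow (by positivity) (by positivity)]
    gcongr
  have h1 := hC (fun _ => 1) aemeasurable_const x 1 one_pos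
  have h2 := hC U hU x 1 one_pos
  have hfin : ∫⁻ z, ENNReal.ofReal ((1 + ‖x‖) ^ ((n : ℝ) + σ)) * b *
      (1 * ENNReal.ofReal ((max ‖z - x‖ 1) ^ (-((n : ℝ) + σ))) +
      U z * ENNReal.ofReal ((max ‖z - x‖ 1) ^ (-((n : ℝ) + σ)))) < ∞ := by
    rw [lintegral_const_mul' _ _ (by finiteness), lintegral_add_left (by fun_prop)]
    refine ENNReal.mul_lt_top (by finiteness)
        (ENNReal.add_lt_top.2 ⟨h1.trans_lt ?_, h2.trans_lt ?_⟩)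
    · have := (maximalFn_one_le x).trans_lt ENNReal.one_lt_top
      finiteness
    · finiteness
  refine lt_of_le_of_lt (lintegral_mono fun z => ?_) hfin
  dsimp only
  rw [enorm_mul, enorm_ofReal_of_nonneg (by positivity), ← add_mul]
  calc _ ≤ ENNReal.ofReal ((1 + ‖x‖) ^ ((n : ℝ) + σ) * (max ‖z - x‖ 1) ^ (-((n : ℝ) + σ))) *
        (b * (1 + U z)) := by
        gcongr
        · exact hw z
        · exact hfU z
    _ = _ := by
        rw [ENNReal.ofReal_mul (by positivity)]
        ring

end Pointwise

/-! ### Norm estimates. -/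

section LpBounds

lemma ae_ne_top_of_eLpNorm_ne_top {X : Type*} [MeasurableSpace X] {μ : Measure X} {f : X → ℝ≥0∞}
    (hf : AEMeasurable f μ) {q : ℝ≥0∞} (hq : q ≠ 0) (h : eLpNorm f q μ ≠ ∞) : ∀ᵐ x ∂μ, f x ≠ ∞ := by
  by_cases hqt : q = ∞
  · subst hqt
    rw [eLpNorm_exponent_top] at h
    filter_upwards [enorm_ae_le_eLpNormEssSup f μ] with x hx
    exact ne_top_of_le_ne_top h hx
  · have h1 := (eLpNorm_lt_top_iff_lintegral_rpow_enorm_lt_top hq hqt).1 h.lt_top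
    simp only [enorm_eq_self] at h1
    filter_upwards [ae_lt_top' (hf.pow_const _) h1.ne] with x hx hx2
    rw [hx2, ENNReal.top_rpow_of_pos (ENNReal.toReal_pos hq hqt)] at hx
    exact lt_irrefl _ hx

lemma eLpNorm_toReal {X : Type*} [MeasurableSpace X] {μ : Measure X} {f : X → ℝ≥0∞}
    (hf : ∀ᵐ x ∂μ, f x ≠ ∞) (q : ℝ≥0∞) : eLpNorm (fun x => (f x).toReal) q μ = eLpNorm f q μ := by
  apply eLpNorm_congr_enorm_ae
  filter_upwards [hf] with x hx
  rw [enorm_eq_self, Real.enorm_of_nonneg ENNReal.toReal_nonneg, ENNReal.ofReal_toReal hx]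

/-- Hölder's inequality for functions with values in `[0,∞]`. -/
lemma eLpNorm_mul_le_of_holder {X : Type*} [MeasurableSpace X] {μ : Measure X} {f g : X → ℝ≥0∞}
    (hfm : AEMeasurable f μ) (hgm : AEMeasurable g μ)
    (hf : ∀ᵐ x ∂μ, f x ≠ ∞) (hg : ∀ᵐ x ∂μ, g x ≠ ∞) {p q r : ℝ≥0∞}
    (h : r⁻¹ = p⁻¹ + q⁻¹) :
    eLpNorm (fun x => f x * g x) r μ ≤ eLpNorm f p μ * eLpNorm g q μ := by
  have hT : ENNReal.HolderTriple p q r := ⟨h.symm⟩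
  have hfg : ∀ᵐ x ∂μ, f x * g x ≠ ∞ := by
    filter_upwards [hf, hg] with x hx hy using ENNReal.mul_ne_top hx hy
  rw [← eLpNorm_toReal hf, ← eLpNorm_toReal hg, ← eLpNorm_toReal hfg]
  have := eLpNorm_smul_le_mul_eLpNorm (p := p) (q := q) (r := r)
    hgm.ennreal_toReal.aestronglyMeasurable hfm.ennreal_toReal.aestronglyMeasurable
  simpa only [ENNReal.toReal_mul, Pi.smul_apply', smul_eq_mul] using! this

variable {n : ℕ}

/-- As `‖V ^ a‖_P = ‖V‖_{P a} ^ a`, this is the maximal theorem at exponent `P a > 1`; `P` itself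
may be below one, or infinite. -/
lemma exists_eLpNorm_maximalFn_add_rpow_le (hn : 1 ≤ n) {P : ℝ≥0∞} {a : ℝ} (ha : 0 < a)
    (hPa : 1 < P * ENNReal.ofReal a) :
    ∃ C : ℝ≥0, ∀ U : EuclideanSpace ℝ (Fin n) → ℝ≥0∞, AEMeasurable U volume →
      eLpNorm (fun x => (maximalFn volume U x + U x) ^ a) P volume ≤
        C * eLpNorm (fun x => U x ^ a) P volume := by
  obtain ⟨C, hC⟩ := exists_eLpNorm_maximalFn_le (volume : Measure (EuclideanSpace ℝ (Fin n)))
    (by rwa [finrank_euclideanSpace_fin]) hPa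
  refine ⟨(C + 1) ^ a, fun U hU => ?_⟩
  have h1 := eLpNorm_enorm_rpow (p := P) (μ := volume) (fun x => maximalFn volume U x + U x) ha
  have h2 := eLpNorm_enorm_rpow (p := P) (μ := volume) U ha
  simp only [enorm_eq_self] at h1 h2
  rw [h1, h2, ENNReal.coe_rpow_of_nonneg _ ha.le, ← ENNReal.mul_rpow_of_nonneg _ _ ha.le]
  apply ENNReal.rpow_le_rpow _ ha.le
  refine (eLpNorm_add_le (measurable_maximalFn hU).aestronglyMeasurable
    hU.aestronglyMeasurable hPa.le).trans ?_
  push_cast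
  rw [add_mul, one_mul]
  gcongr
  exact hC U hU

/-- If the integrated increments of `f` are dominated by a function in `L^p`, then `f` has a
fractional derivative in `L^p`. -/
lemma exists_hasFracDeriv_of_increment_le (hn : 1 ≤ n) {σ p : ℝ} (hσ0 : 0 < σ) (hσ1 : σ < 1)
    (hp : 1 < p) :
    ∃ C : ℝ≥0, ∀ (f : EuclideanSpace ℝ (Fin n) → ℂ) (W : EuclideanSpace ℝ (Fin n) → ℝ≥0∞) (κ : ℝ≥0),
      Integrable (fun x => (((1 + ‖x‖) ^ (-((n : ℝ) + σ)) : ℝ) : ℂ) * f x) volume →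
      AEMeasurable W volume → eLpNorm W (ENNReal.ofReal p) volume ≠ ∞ →
      (∀ᵐ x, ∫⁻ y, ‖f (x + y) - f x‖ₑ * ENNReal.ofReal (‖y‖ ^ (-((n : ℝ) + σ))) ≤ κ * W x) →
      ∃ h : EuclideanSpace ℝ (Fin n) → ℂ, HasFracDeriv σ f h ∧ MemLp h (ENNReal.ofReal p) volume ∧
        eLpNorm h (ENNReal.ofReal p) volume ≤ C * κ * eLpNorm W (ENNReal.ofReal p) volume := by
  have hp0 : 0 < p := by linarith
  obtain ⟨c, hc⟩ := exists_hasFracDeriv_singularIntegral (n := n) hn hσ0 hσ1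
  refine ⟨‖c‖₊, fun f W κ hfw hWm hWfin hDW => ?_⟩
  have hfm : AEStronglyMeasurable f volume :=
    (locallyIntegrable_of_weighted hfw).aestronglyMeasurable
  set D : EuclideanSpace ℝ (Fin n) → ℝ≥0∞ := fun x => ∫⁻ y, ‖f (x + y) - f x‖ₑ *
    ENNReal.ofReal (‖y‖ ^ (-((n : ℝ) + σ))) with hD
  -- Hölder's inequality with `W ∈ L^p` and `φ ∈ L^{p'}` supplies the absolute convergence required
  -- for the singular integral to represent the derivative.
  have hDφ : ∀ φ : 𝓢(EuclideanSpace ℝ (Fin n), ℂ), ∫⁻ x, D x * ‖φ x‖ₑ ≠ ∞ := by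
    intro φ
    have hconj := Real.HolderConjugate.conjExponent hp
    have hle : ∫⁻ x, D x * ‖φ x‖ₑ ≤ (κ : ℝ≥0∞) * ∫⁻ x, (W * fun x => ‖φ x‖ₑ) x := by
      rw [← lintegral_const_mul' _ _ ENNReal.coe_ne_top]
      apply lintegral_mono_ae
      filter_upwards [hDW] with x hx
      rw [Pi.mul_apply, ← mul_assoc]
      gcongr
    refine ne_top_of_le_ne_top (ENNReal.mul_ne_top ENNReal.coe_ne_top ?_) hle
    refine ne_top_of_le_ne_top ?_ (ENNReal.lintegral_mul_le_Lp_mul_Lq volume hconj hWm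
      φ.continuous.measurable.enorm.aemeasurable)
    have hq0 := hconj.symm.pos
    have e1 := eLpNorm_eq_lintegral_rpow_enorm_toReal (p := ENNReal.ofReal p) (μ := volume)
      (ENNReal.ofReal_pos.2 hp0).ne' ENNReal.ofReal_ne_top (f := W)
    have e2 := eLpNorm_eq_lintegral_rpow_enorm_toReal (p := ENNReal.ofReal p.conjExponent)
      (μ := volume) (ENNReal.ofReal_pos.2 hq0).ne' ENNReal.ofReal_ne_top (f := ⇑φ)
    rw [ENNReal.toReal_ofReal hp0.le] at e1
    rw [ENNReal.toReal_ofReal hq0.le] at e2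
    simp only [enorm_eq_self] at e1
    have h2 : eLpNorm (⇑φ) (ENNReal.ofReal p.conjExponent) volume ≠ ∞ :=
      (φ.memLp (ENNReal.ofReal p.conjExponent) volume).2.ne
    rw [e1] at hWfin
    rw [e2] at h2
    exact ENNReal.mul_ne_top hWfin h2
  refine ⟨_, hc f hfw hDφ, ?_⟩
  set h := fun x => c * ∫ y, (f (x + y) - f x) * ((‖y‖ ^ (-((n : ℝ) + σ)) : ℝ) : ℂ) with hh
  have hhm : AEStronglyMeasurable h volume := by
    apply AEStronglyMeasurable.const_mul
    apply AEStronglyMeasurable.integral_prod_right' (f := fun z : EuclideanSpace ℝ (Fin n) ×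
      EuclideanSpace ℝ (Fin n) => (f (z.1 + z.2) - f z.1) *
        ((‖z.2‖ ^ (-((n : ℝ) + σ)) : ℝ) : ℂ))
    refine ((aestronglyMeasurable_comp_add hfm).sub hfm.comp_fst).mul
      (Measurable.aestronglyMeasurable ?_)
    fun_prop
  have hhW : ∀ᵐ x, ‖h x‖ₑ ≤ (‖c‖₊ * κ : ℝ≥0) * ‖W x‖ₑ := by
    filter_upwards [hDW] with x hx
    rw [ENNReal.coe_mul, mul_assoc, hh, enorm_mul, enorm_eq_self]
    refine mul_le_mul_right (le_trans ?_ hx) _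
    refine (enorm_integral_le_lintegral_enorm _).trans (le_of_eq ?_)
    simp only [enorm_mul, enorm_ofReal_of_nonneg (Real.rpow_nonneg (norm_nonneg _) _)]
  have hnorm : eLpNorm h (ENNReal.ofReal p) volume ≤
      (‖c‖₊ * κ : ℝ≥0) * eLpNorm W (ENNReal.ofReal p) volume :=
    eLpNorm_le_nnreal_smul_eLpNorm_of_ae_le_mul' hhW _
  refine ⟨⟨hhm, hnorm.trans_lt (ENNReal.mul_lt_top ENNReal.coe_lt_top hWfin.lt_top)⟩, ?_⟩
  exact hnorm.trans_eq (by push_cast; rfl)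

end LpBounds

/-! ### Assembly of the main estimate. -/

theorem propositionA1 (n : ℕ) (hn : 1 ≤ n) (α σ s p p₂ : ℝ) (p₁ : ℝ≥0∞)
    (hα0 : 0 < α) (hα1 : α < 1) (hσ0 : 0 < σ) (hσα : σ < α)
    (hs0 : σ / α < s) (hs1 : s < 1) (hp : 1 < p)
    (hpp : (ENNReal.ofReal p)⁻¹ = p₁⁻¹ + (ENNReal.ofReal p₂)⁻¹)
    (hp₁ : 1 < ENNReal.ofReal (1 - σ / (α * s)) * p₁)
    (hp₂ : 1 < σ / s * p₂) :
    ∃ C : ℝ≥0, ∀ (K : ℝ≥0) (F : ℂ → ℂ), HolderWith K α.toNNReal F →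
      ∀ u g : EuclideanSpace ℝ (Fin n) → ℂ,
        MemLp (fun x => ‖u x‖ ^ (α - σ / s)) p₁ volume →
        HasFracDeriv s u g →
        MemLp g (ENNReal.ofReal (σ / s * p₂)) volume →
        ∃ h : EuclideanSpace ℝ (Fin n) → ℂ,
          HasFracDeriv σ (fun x => F (u x)) h ∧
          MemLp h (ENNReal.ofReal p) volume ∧
          eLpNorm h (ENNReal.ofReal p) volume ≤
            C * K * eLpNorm (fun x => ‖u x‖ ^ (α - σ / s)) p₁ volume *
              eLpNorm g (ENNReal.ofReal (σ / s * p₂)) volume ^ (σ / s) := by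
  have hspos : 0 < s := (div_pos hσ0 hα0).trans hs0
  have hσ1 : σ < 1 := hσα.trans hα1
  set τ := α * s with hτ
  have hτ0 : 0 < τ := mul_pos hα0 hspos
  have hστ : σ < τ := by rwa [div_lt_iff₀ hα0, mul_comm] at hs0
  have hτ1 : τ < 1 := by nlinarith
  set θ := σ / s with hθ
  have hθ0 : 0 < θ := div_pos hσ0 hspos
  set a := σ / τ with ha
  set b := 1 - σ / τ with hb
  have ha0 : 0 < a := div_pos hσ0 hτ0
  have hb0 : 0 < b := by rw [hb, sub_pos, div_lt_one hτ0]; exact hστ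
  have hαa : α * a = θ := by rw [ha, hθ, hτ]; field_simp
  have hαb : α * b = α - θ := by
    change α * (1 - a) = _
    rw [mul_sub, mul_one, hαa]
  have hp₂0 : 0 < p₂ := by
    by_contra hneg
    nlinarith
  have hp0 : 0 < p := by linarith
  have hp₂ne : ENNReal.ofReal p₂ ≠ 0 := (ENNReal.ofReal_pos.2 hp₂0).ne'
  have hp₁ne : p₁ ≠ 0 := by
    rintro rfl
    simp at hp₁
  set q := ENNReal.ofReal (θ * p₂) with hq
  have hq1 : 1 < q := by rwa [hq, ENNReal.one_lt_ofReal]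
  have hqeq : ENNReal.ofReal p₂ * ENNReal.ofReal θ = q := by
    rw [hq, mul_comm, ENNReal.ofReal_mul hθ0.le]
  have h1a : 1 < ENNReal.ofReal p₂ * ENNReal.ofReal a := by
    rw [← ENNReal.ofReal_mul hp₂0.le, ENNReal.one_lt_ofReal]
    -- `θ = α a` with `α < 1`, so `1 < θ p₂` implies `1 < a p₂`: one hypothesis serves both
    -- applications of the maximal theorem on the `g` side.
    have : θ ≤ a := by rw [← hαa]; nlinarith
    nlinarith
  have h1b : 1 < p₁ * ENNReal.ofReal b := by rwa [mul_comm]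
  obtain ⟨CH, hCH⟩ := exists_norm_sub_le_maximalFn n hspos hs1
  obtain ⟨CP, hCP⟩ := exists_lintegral_increment_le hn hσ0 hστ hτ1
  obtain ⟨CD, hCD⟩ := exists_hasFracDeriv_of_increment_le (n := n) hn hσ0 hσ1 hp
  obtain ⟨CM, hCM⟩ := exists_eLpNorm_maximalFn_le
    (volume : Measure (EuclideanSpace ℝ (Fin n))) (by rwa [finrank_euclideanSpace_fin]) hq1
  obtain ⟨CA, hCA⟩ := exists_eLpNorm_maximalFn_add_rpow_le hn ha0 h1a
  obtain ⟨CB, hCB⟩ := exists_eLpNorm_maximalFn_add_rpow_le hn hb0 h1b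
  refine ⟨CD * (CP * (CH ^ α + 1)) * (CA * CM ^ θ * CB), fun K F hF u g hu hug hg => ?_⟩
  have hFc : Continuous F := hF.continuous (by simpa using hα0)
  have hum : AEStronglyMeasurable u volume :=
    (locallyIntegrable_of_weighted hug.1).aestronglyMeasurable
  set f : EuclideanSpace ℝ (Fin n) → ℂ := fun x => F (u x) with hf
  have hfm : AEStronglyMeasurable f volume := hFc.comp_aestronglyMeasurable hum
  set M := maximalFn volume (fun z => ‖g z‖ₑ) with hM
  have hgm : AEMeasurable (fun z => ‖g z‖ₑ) volume := hg.1.enorm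
  have hMm : Measurable M := measurable_maximalFn hgm
  set G : EuclideanSpace ℝ (Fin n) → ℝ≥0∞ := fun x => M x ^ α with hG
  set U : EuclideanSpace ℝ (Fin n) → ℝ≥0∞ := fun x => ‖u x‖ₑ ^ α with hU
  have hGm : AEMeasurable G volume := (hMm.pow_const α).aemeasurable
  have hUm : AEMeasurable U volume := hum.enorm.pow_const α
  set G' := fun x => (maximalFn volume G x + G x) ^ a with hG'
  set H' := fun x => (maximalFn volume U x + U x) ^ b with hH'
  have hG'm : AEMeasurable G' volume :=
    ((measurable_maximalFn hGm).aemeasurable.add hGm).pow_const a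
  have hH'm : AEMeasurable H' volume :=
    ((measurable_maximalFn hUm).aemeasurable.add hUm).pow_const b
  -- norms of the two factors
  have hMq : eLpNorm M q volume ≤ CM * eLpNorm g q volume := by
    refine (hCM _ hgm).trans_eq ?_
    rw [eLpNorm_enorm]
  have hMtop : ∀ᵐ x, M x ≠ ∞ :=
    ae_ne_top_of_eLpNorm_ne_top hMm.aemeasurable (zero_lt_one.trans hq1).ne'
      (ne_top_of_le_ne_top (ENNReal.mul_ne_top ENNReal.coe_ne_top hg.2.ne) hMq)
  have hG'norm : eLpNorm G' (ENNReal.ofReal p₂) volume ≤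
      CA * (CM ^ θ : ℝ≥0) * eLpNorm g q volume ^ θ := by
    refine (hCA G hGm).trans ?_
    have h1 := eLpNorm_enorm_rpow (p := ENNReal.ofReal p₂) (μ := volume) M hθ0
    simp only [enorm_eq_self] at h1
    have h2 : (fun x => G x ^ a) = fun x => M x ^ θ := by
      ext x
      rw [hG, ← ENNReal.rpow_mul, hαa]
    rw [h2, h1, hqeq, mul_assoc, ENNReal.coe_rpow_of_nonneg _ hθ0.le,
      ← ENNReal.mul_rpow_of_nonneg _ _ hθ0.le]
    gcongr
  have hH'norm : eLpNorm H' p₁ volume ≤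
      CB * eLpNorm (fun x => ‖u x‖ ^ (α - θ)) p₁ volume := by
    refine (hCB U hUm).trans_eq ?_
    congr 1
    apply eLpNorm_congr_enorm_ae
    refine Filter.Eventually.of_forall fun x => ?_
    have hpos : 0 ≤ α - θ := by rw [← hαb]; positivity
    rw [enorm_eq_self, hU, ← ENNReal.rpow_mul, hαb, Real.enorm_of_nonneg (by positivity),
      ← ENNReal.ofReal_rpow_of_nonneg (norm_nonneg _) hpos, ofReal_norm]
  have hG'fin : eLpNorm G' (ENNReal.ofReal p₂) volume ≠ ∞ := by
    refine ne_top_of_le_ne_top (ENNReal.mul_ne_top (by finiteness) ?_) hG'norm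
    exact ENNReal.rpow_ne_top_of_nonneg hθ0.le hg.2.ne
  have hH'fin : eLpNorm H' p₁ volume ≠ ∞ :=
    ne_top_of_le_ne_top (ENNReal.mul_ne_top ENNReal.coe_ne_top hu.2.ne) hH'norm
  have hG'top := ae_ne_top_of_eLpNorm_ne_top hG'm hp₂ne hG'fin
  have hH'top := ae_ne_top_of_eLpNorm_ne_top hH'm hp₁ne hH'fin
  set W := fun x => G' x * H' x with hW
  have hWm : AEMeasurable W volume := hG'm.mul hH'm
  have hWnorm : eLpNorm W (ENNReal.ofReal p) volume ≤
      eLpNorm G' (ENNReal.ofReal p₂) volume * eLpNorm H' p₁ volume :=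
    eLpNorm_mul_le_of_holder hG'm hH'm hG'top hH'top (by rw [hpp, add_comm])
  have hWfin : eLpNorm W (ENNReal.ofReal p) volume ≠ ∞ :=
    ne_top_of_le_ne_top (ENNReal.mul_ne_top hG'fin hH'fin) hWnorm
  -- the increments of `f`
  have hHol : ∀ x y, ‖f x - f y‖ₑ ≤ K * ‖u x - u y‖ₑ ^ α := by
    intro x y
    have := hF (u x) (u y)
    rwa [Real.coe_toNNReal _ hα0.le, edist_eq_enorm_sub, edist_eq_enorm_sub] at this
  -- A common constant for the two increment bounds: `K * CH ^ α` for the Hölder type bound, `K` for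
  -- the bound by size. Both also use `(v + w) ^ α ≤ v ^ α + w ^ α`.
  set κ : ℝ≥0 := K * (CH ^ α + 1) with hκ
  have hsize : ∀ x z, ‖f z - f x‖ₑ ≤ κ * (U z + U x) := by
    intro x z
    calc ‖f z - f x‖ₑ ≤ K * ‖u z - u x‖ₑ ^ α := hHol z x
      _ ≤ κ * (U z + U x) := by
        gcongr
        · rw [hκ]
          exact le_mul_of_one_le_right' le_add_self
        · exact (ENNReal.rpow_le_rpow enorm_sub_le hα0.le).trans
            (ENNReal.rpow_add_le_add_rpow _ _ hα0.le hα1.le)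
  have hLeb := ae_isLebesguePoint (locallyIntegrable_of_weighted hug.1)
  have hincr : ∀ᵐ x, ∀ᵐ z, ‖f z - f x‖ₑ ≤
      κ * (ENNReal.ofReal (‖z - x‖ ^ τ) * (G z + G x)) := by
    filter_upwards [hLeb, hMtop] with x hx hMx
    filter_upwards [hLeb, hMtop] with z hz hMz
    calc ‖f z - f x‖ₑ ≤ K * ‖u z - u x‖ₑ ^ α := hHol z x
      _ ≤ K * (CH * ENNReal.ofReal (‖z - x‖ ^ s) * (M z + M x)) ^ α := by
        gcongr
        exact hCH u g hug hg.1 z x hz hx hMz hMx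
      _ = (K * (CH ^ α : ℝ≥0)) * (ENNReal.ofReal (‖z - x‖ ^ τ) * (M z + M x) ^ α) := by
        rw [ENNReal.mul_rpow_of_nonneg _ _ hα0.le, ENNReal.mul_rpow_of_nonneg _ _ hα0.le,
          ENNReal.coe_rpow_of_nonneg _ hα0.le, ENNReal.ofReal_rpow_of_nonneg (by positivity) hα0.le,
          ← Real.rpow_mul (norm_nonneg _), hτ, mul_comm s α]
        ring
      _ ≤ κ * (ENNReal.ofReal (‖z - x‖ ^ τ) * (G z + G x)) := by
        rw [hκ]
        push_cast
        gcongr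
        · exact le_self_add
        · exact ENNReal.rpow_add_le_add_rpow _ _ hα0.le hα1.le
  -- Finiteness is read off from the finite norm of the power `G'`, since a positive power of `∞` is
  -- `∞`.
  have hGfin : ∀ᵐ x, maximalFn volume G x + G x ≠ ∞ := by
    filter_upwards [hG'top] with x hx h0
    apply hx
    simp only [hG']
    rw [h0, ENNReal.top_rpow_of_pos ha0]
  have hUfin : ∀ᵐ x, maximalFn volume U x + U x ≠ ∞ := by
    filter_upwards [hH'top] with x hx h0
    apply hx
    simp only [hH']
    rw [h0, ENNReal.top_rpow_of_pos hb0]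
  have hDW : ∀ᵐ x, ∫⁻ y, ‖f (x + y) - f x‖ₑ *
      ENNReal.ofReal (‖y‖ ^ (-((n : ℝ) + σ))) ≤ (CP * κ : ℝ≥0) * W x := by
    filter_upwards [hincr, hGfin, hUfin] with x h1 h2 h3
    rw [ENNReal.coe_mul]
    exact hCP f G U κ hGm hUm x h1 (Filter.Eventually.of_forall fun z => hsize x z) h2 h3
  -- integrability of `f` against the weight
  have hfw : Integrable (fun x => (((1 + ‖x‖) ^ (-((n : ℝ) + σ)) : ℝ) : ℂ) * f x) volume := by
    obtain ⟨x, hx⟩ := hUfin.exists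
    refine integrable_weighted_of_maximalFn_ne_top hσ0 hfm hUm (‖F 0‖₊ + K) (fun z => ?_)
      (x := x) (fun h0 => hx (by rw [h0, top_add]))
    have h1 := hF (u z) 0
    rw [Real.coe_toNNReal _ hα0.le, edist_eq_enorm_sub, edist_eq_enorm_sub, sub_zero] at h1
    calc ‖f z‖ₑ = ‖F 0 + (F (u z) - F 0)‖ₑ := by rw [add_sub_cancel]
      _ ≤ ‖F 0‖ₑ + K * U z := (enorm_add_le _ _).trans (by gcongr)
      _ ≤ (‖F 0‖ₑ + K) * 1 + (‖F 0‖ₑ + K) * U z := by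
        rw [mul_one]
        gcongr
        · exact le_self_add
        · exact le_add_self
      _ = _ := by
        push_cast
        rw [enorm_eq_nnnorm]
        ring
  obtain ⟨h, hh1, hh2, hh3⟩ := hCD f W (CP * κ) hfw hWm hWfin hDW
  refine ⟨h, hh1, hh2, ?_⟩
  calc eLpNorm h (ENNReal.ofReal p) volume
      ≤ CD * (CP * κ : ℝ≥0) * ((CA * (CM ^ θ : ℝ≥0) * eLpNorm g q volume ^ θ) *
          (CB * eLpNorm (fun x => ‖u x‖ ^ (α - θ)) p₁ volume)) := by
        refine hh3.trans ?_
        gcongr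
        exact hWnorm.trans (mul_le_mul' hG'norm hH'norm)
    _ = _ := by
        rw [hκ]
        push_cast
        ring
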